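/- Let $G$ and $H$ be finite groups. A finite $G\times H$-set is *$H$-free* if $H=1\times H$ acts freely on it; a finitely generated $\mathbb Q[G\times H]$-module is *$H$-free* if it is free as a $\mathbb Q[H]$-module. Let $A(G,H)$ be the Grothendieck group of the monoid of isomorphism classes of finite $H$-free $G\times H$-sets under disjoint union, let $R(G,H)$ be the Grothendieck group of the monoid of isomorphism classes of finitely generated $H$-free $\mathbb Q[G\times H]$-modules under direct sum, and let $f':A(G,H)\to R(G,H)$ be the homomorphism $[X]\mapsto[\mathbb Q[X]]$, with kernel $N(G,H)$. Similarly, for a finite group $\Gamma$, let $A(\Gamma)$ and $R(\Gamma)$ be the Grothendieck groups of finite $\Gamma$-sets and of finitely generated $\mathbb Q[\Gamma]$-modules, and let $N(\Gamma)$ be the kernel of $A(\Gamma)\to R(\Gamma)$, $[X]\mapsto[\mathbb Q[X]]$. Regard $A(G,H)$ as a subgroup of $A(G\times H)$. For a subquotient $L/C$ of $G\times H$ (that is, $C\trianglelefteq L\le G\times H$) let $L/C{\uparrow}:A(L/C)\to A(G\times H)$ be the homomorphism $[X]\mapsto[(G\times H)\times_L X]$, and let $\tilde N(L/C)$ be the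 subgroup of those $x\in N(L/C)$ with $L/C{\uparrow}\,x\in A(G,H)$. **Proposition.** Let $p$ be a prime, $k\ge 0$ an integer, $G$ a cyclic group of order $p^k$, and $H\cong\mathbb Z_p$. Then $f':A(G,H)\to R(G,H)$ is an isomorphism, and $A(G,H)$ and $R(G,H)$ are free $\mathbb Z$-modules of rank $kp+1$. Consequently $N(G,H)=0$, and $$N(G,H)=\sum L/C{\uparrow}\,\tilde N(L/C),$$ where the sum is taken over all subquotients $L/C$ of $G\times H$ isomorphic to $T\times H$ with $T$ one of the following: $\mathbb Z_p\times\mathbb Z_p$; a dihedral group of order $2^n\ge 8$ (if $p=2$); a nonabelian group of order $p^3$ and exponent $p$. -/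

import Mathlib

universe u v

namespace RelBurnside

open MonoidAlgebra

/-! ### Grothendieck constructions -/

/-- The homomorphism between Grothendieck groups induced by a homomorphism of commutative
monoids. -/
noncomputable def grothendieckMap {M N : Type*} [AddCommMonoid M] [AddCommMonoid N] (φ : M →+ N) :
    Algebra.GrothendieckAddGroup M →+ Algebra.GrothendieckAddGroup N :=
  Algebra.GrothendieckAddGroup.lift (Algebra.GrothendieckAddGroup.of.comp φ)

/-! ### Finite `Γ`-sets and the Burnside group -/

/-- A finite set with an action of the group `Γ`. -/
structure FinGSet (Γ : Type u) [Group Γ] where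
  carrier : Type u
  [action : MulAction Γ carrier]
  [finite : Finite carrier]

attribute [instance] FinGSet.action FinGSet.finite

/-- Isomorphism of `Γ`-sets. -/
instance FinGSet.setoid (Γ : Type u) [Group Γ] : Setoid (FinGSet Γ) where
  r X Y := ∃ e : X.carrier ≃ Y.carrier, ∀ (g : Γ) (x : X.carrier), e (g • x) = g • e x
  iseqv :=
    { refl := fun X => ⟨Equiv.refl _, fun _ _ => rfl⟩
      symm := by
        rintro X Y ⟨e, he⟩
        exact ⟨e.symm, fun g y => e.injective (by simp [he])⟩
      trans := by
        rintro X Y Z ⟨e, he⟩ ⟨e', he'⟩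
        exact ⟨e.trans e', fun g x => by simp [he, he']⟩ }

/-- Isomorphism classes of finite `Γ`-sets. -/
def GSetClass (Γ : Type u) [Group Γ] : Type (u + 1) := Quotient (FinGSet.setoid Γ)

/-- Disjoint union. -/
def FinGSet.sum {Γ : Type u} [Group Γ] (X Y : FinGSet Γ) : FinGSet Γ where
  carrier := X.carrier ⊕ Y.carrier

/-- The empty `Γ`-set. -/
def FinGSet.empty (Γ : Type u) [Group Γ] : FinGSet Γ where
  carrier := PEmpty
  action := { smul := fun _ x => x, one_smul := fun _ => rfl, mul_smul := fun _ _ _ => rfl }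

theorem FinGSet.sum_congr {Γ : Type u} [Group Γ] {X X' Y Y' : FinGSet Γ}
    (hX : X ≈ X') (hY : Y ≈ Y') : X.sum Y ≈ X'.sum Y' := by
  obtain ⟨e, he⟩ := hX
  obtain ⟨e', he'⟩ := hY
  refine ⟨Equiv.sumCongr e e', ?_⟩
  rintro g (x | x)
  · exact congrArg Sum.inl (he g x)
  · exact congrArg Sum.inr (he' g x)

instance (Γ : Type u) [Group Γ] : Add (GSetClass Γ) :=
  ⟨Quotient.map₂ FinGSet.sum fun _ _ hX _ _ hY => FinGSet.sum_congr hX hY⟩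

instance (Γ : Type u) [Group Γ] : Zero (GSetClass Γ) := ⟨Quotient.mk _ (FinGSet.empty Γ)⟩

/-- The monoid of isomorphism classes of finite `Γ`-sets under disjoint union. -/
instance (Γ : Type u) [Group Γ] : AddCommMonoid (GSetClass Γ) where
  add_assoc := by
    rintro ⟨X⟩ ⟨Y⟩ ⟨Z⟩
    refine Quotient.sound ⟨Equiv.sumAssoc _ _ _, ?_⟩
    rintro g ((x | x) | x) <;> rfl
  zero_add := by
    rintro ⟨X⟩
    refine Quotient.sound ⟨Equiv.emptySum PEmpty X.carrier, ?_⟩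
    rintro g (x | x)
    · exact x.elim
    · rfl
  add_zero := by
    rintro ⟨X⟩
    refine Quotient.sound ⟨Equiv.sumEmpty X.carrier PEmpty, ?_⟩
    rintro g (x | x)
    · rfl
    · exact x.elim
  add_comm := by
    rintro ⟨X⟩ ⟨Y⟩
    refine Quotient.sound ⟨Equiv.sumComm _ _, ?_⟩
    rintro g (x | x) <;> rfl
  nsmul := nsmulRec

/-- The (additive group of the) Burnside ring `A(Γ)`. -/
abbrev Burnside (Γ : Type u) [Group Γ] : Type (u + 1) :=
  Algebra.GrothendieckAddGroup (GSetClass Γ)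

/-! ### Finitely generated `ℚ[Γ]`-modules and the rational representation group -/

/-- A finitely generated module over the rational group algebra of `Γ`. -/
structure FGMod (Γ : Type u) [Group Γ] where
  carrier : Type u
  [addCommGroup : AddCommGroup carrier]
  [module : Module (MonoidAlgebra ℚ Γ) carrier]
  [finite : Module.Finite (MonoidAlgebra ℚ Γ) carrier]

attribute [instance] FGMod.addCommGroup FGMod.module FGMod.finite

/-- Isomorphism of `ℚ[Γ]`-modules. -/
instance FGMod.setoid (Γ : Type u) [Group Γ] : Setoid (FGMod Γ) where
  r M N := Nonempty (M.carrier ≃ₗ[MonoidAlgebra ℚ Γ] N.carrier)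
  iseqv :=
    { refl := fun _ => ⟨LinearEquiv.refl _ _⟩
      symm := fun ⟨e⟩ => ⟨e.symm⟩
      trans := fun ⟨e⟩ ⟨e'⟩ => ⟨e.trans e'⟩ }

/-- Isomorphism classes of finitely generated `ℚ[Γ]`-modules. -/
def ModClass (Γ : Type u) [Group Γ] : Type (u + 1) := Quotient (FGMod.setoid Γ)

/-- Direct sum. -/
noncomputable def FGMod.prod {Γ : Type u} [Group Γ] (M N : FGMod Γ) : FGMod Γ where
  carrier := M.carrier × N.carrier

/-- The zero module. -/
noncomputable def FGMod.zero (Γ : Type u) [Group Γ] : FGMod Γ where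
  carrier := PUnit

noncomputable instance (Γ : Type u) [Group Γ] : Add (ModClass Γ) :=
  ⟨Quotient.map₂ FGMod.prod fun _ _ ⟨e⟩ _ _ ⟨e'⟩ => ⟨e.prodCongr e'⟩⟩

noncomputable instance (Γ : Type u) [Group Γ] : Zero (ModClass Γ) := ⟨Quotient.mk _ (FGMod.zero Γ)⟩

/-- The monoid of isomorphism classes of finitely generated `ℚ[Γ]`-modules under direct sum. -/
noncomputable instance (Γ : Type u) [Group Γ] : AddCommMonoid (ModClass Γ) where
  add_assoc := by
    rintro ⟨X⟩ ⟨Y⟩ ⟨Z⟩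
    exact Quotient.sound ⟨LinearEquiv.prodAssoc _ _ _ _⟩
  zero_add := by
    rintro ⟨X⟩
    exact Quotient.sound ⟨(LinearEquiv.uniqueProd :
      (PUnit.{u + 1} × X.carrier) ≃ₗ[MonoidAlgebra ℚ Γ] X.carrier)⟩
  add_zero := by
    rintro ⟨X⟩
    exact Quotient.sound ⟨(LinearEquiv.prodUnique :
      (X.carrier × PUnit.{u + 1}) ≃ₗ[MonoidAlgebra ℚ Γ] X.carrier)⟩
  add_comm := by
    rintro ⟨X⟩ ⟨Y⟩
    exact Quotient.sound ⟨LinearEquiv.prodComm _ _ _⟩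
  nsmul := nsmulRec

/-- The (additive group of the) rational representation ring `R(Γ)`. -/
abbrev RatRep (Γ : Type u) [Group Γ] : Type (u + 1) :=
  Algebra.GrothendieckAddGroup (ModClass Γ)

/-! ### The permutation module map `f : A(Γ) → R(Γ)` -/

/-- The permutation module `ℚ[X]`. -/
noncomputable def FinGSet.perm {Γ : Type u} [Group Γ] (X : FinGSet Γ) : FGMod Γ where
  carrier := (Representation.ofMulAction ℚ Γ X.carrier).asModule
  finite :=
    haveI : Module.Finite ℚ (MonoidAlgebra ℚ X.carrier) :=
      Module.Finite.equiv (MonoidAlgebra.coeffLinearEquiv (S := ℚ) (M := X.carrier) ℚ).symm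
    Module.Finite.of_restrictScalars_finite ℚ (MonoidAlgebra ℚ Γ) _

/-- An additive bijection between `ℚ[Γ]`-modules that commutes with all monomials on additive
generators is `ℚ[Γ]`-linear. -/
def linearEquivOfMonomial {Γ M N : Type*} [Group Γ] [AddCommGroup M] [AddCommGroup N]
    [Module (MonoidAlgebra ℚ Γ) M] [Module (MonoidAlgebra ℚ Γ) N] (e : M ≃+ N) (S : Set M)
    (hS : AddSubmonoid.closure S = ⊤)
    (he : ∀ (g : Γ) (a : ℚ), ∀ m ∈ S, e (single g a • m) = (single g a : MonoidAlgebra ℚ Γ) • e m) :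
    M ≃ₗ[MonoidAlgebra ℚ Γ] N where
  toAddEquiv := e
  map_smul' := by
    intro r m
    change e (r • m) = r • e m
    induction r using MonoidAlgebra.induction_linear with
    | zero => simp
    | add x y hx hy => simp [add_smul, hx, hy]
    | single g a =>
      have hm : m ∈ AddSubmonoid.closure S := hS ▸ AddSubmonoid.mem_top m
      induction hm using AddSubmonoid.closure_induction with
      | mem m hm => exact he g a m hm
      | zero => simp
      | add x y _ _ hx hy => simp [hx, hy]

/-- The monomials of `ℚ[X]`. -/
def monomials (X : Type*) : Set (MonoidAlgebra ℚ X) := {m | ∃ x a, m = single x a}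

theorem closure_monomials (X : Type*) : AddSubmonoid.closure (monomials X) = ⊤ := by
  refine top_unique fun m _ => ?_
  induction m using MonoidAlgebra.induction_linear with
  | zero => exact zero_mem _
  | add x y hx hy => exact add_mem (hx trivial) (hy trivial)
  | single x a => exact AddSubmonoid.subset_closure ⟨x, a, rfl⟩

theorem perm_single_smul {Γ X : Type*} [Group Γ] [MulAction Γ X] (g : Γ) (a b : ℚ) (x : X) :
    (single g a : MonoidAlgebra ℚ Γ) •
      (show (Representation.ofMulAction ℚ Γ X).asModule from (single x b : MonoidAlgebra ℚ X)) =
    (show (Representation.ofMulAction ℚ Γ X).asModule from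
      (single (g • x) (a * b) : MonoidAlgebra ℚ X)) := by
  rw [Representation.single_smul]
  change a • (Representation.ofMulAction ℚ Γ X g) (single x b) = single (g • x) (a * b)
  rw [Representation.ofMulAction_single]
  simp

theorem FinGSet.perm_congr {Γ : Type u} [Group Γ] {X Y : FinGSet Γ} (h : X ≈ Y) :
    X.perm ≈ Y.perm := by
  obtain ⟨e, he⟩ := h
  refine ⟨linearEquivOfMonomial (M := (Representation.ofMulAction ℚ Γ X.carrier).asModule)
    (N := (Representation.ofMulAction ℚ Γ Y.carrier).asModule)
    (MonoidAlgebra.mapDomainLinearEquiv ℚ ℚ e).toAddEquiv (monomials X.carrier)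
    (closure_monomials X.carrier) ?_⟩
  rintro g a _ ⟨x, b, rfl⟩
  erw [perm_single_smul]
  change mapDomainLinearEquiv ℚ ℚ e (single (g • x) (a * b)) =
    (single g a : MonoidAlgebra ℚ Γ) •
    (show (Representation.ofMulAction ℚ Γ Y.carrier).asModule from
      mapDomainLinearEquiv ℚ ℚ e (single x b))
  rw [mapDomainLinearEquiv_single, mapDomainLinearEquiv_single, perm_single_smul, he]

/-- `ℚ[X ⊔ Y] ≃ ℚ[X] × ℚ[Y]` as groups. -/
noncomputable def sumAddEquiv (X Y : Type*) :
    MonoidAlgebra ℚ (X ⊕ Y) ≃+ MonoidAlgebra ℚ X × MonoidAlgebra ℚ Y :=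
  ((MonoidAlgebra.coeffLinearEquiv ℚ).trans
    ((Finsupp.sumFinsuppLEquivProdFinsupp ℚ).trans
      ((MonoidAlgebra.coeffLinearEquiv ℚ).symm.prodCongr
        (MonoidAlgebra.coeffLinearEquiv ℚ).symm))).toAddEquiv

theorem sumAddEquiv_inl {X Y : Type*} (x : X) (a : ℚ) :
    sumAddEquiv X Y (single (Sum.inl x) a) = (single x a, 0) := by
  refine Prod.ext ?_ ?_ <;> ext y <;> classical simp [sumAddEquiv, Finsupp.single_apply]

theorem sumAddEquiv_inr {X Y : Type*} (y : Y) (a : ℚ) :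
    sumAddEquiv X Y (single (Sum.inr y) a) = (0, single y a) := by
  refine Prod.ext ?_ ?_ <;> ext y <;> classical simp [sumAddEquiv, Finsupp.single_apply]

theorem FinGSet.perm_sum {Γ : Type u} [Group Γ] (X Y : FinGSet Γ) :
    (X.sum Y).perm ≈ X.perm.prod Y.perm := by
  refine ⟨linearEquivOfMonomial
    (M := (Representation.ofMulAction ℚ Γ (X.carrier ⊕ Y.carrier)).asModule)
    (N := (Representation.ofMulAction ℚ Γ X.carrier).asModule ×
      (Representation.ofMulAction ℚ Γ Y.carrier).asModule)
    (sumAddEquiv X.carrier Y.carrier) (monomials (X.carrier ⊕ Y.carrier))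
    (closure_monomials (X.carrier ⊕ Y.carrier)) ?_⟩
  rintro g a _ ⟨x, b, rfl⟩
  erw [perm_single_smul]
  rcases x with x | x
  · erw [sumAddEquiv_inl, sumAddEquiv_inl]
    exact Prod.ext (perm_single_smul g a b x).symm
      (smul_zero (A := (Representation.ofMulAction ℚ Γ Y.carrier).asModule) _).symm
  · erw [sumAddEquiv_inr, sumAddEquiv_inr]
    exact Prod.ext (smul_zero (A := (Representation.ofMulAction ℚ Γ X.carrier).asModule) _).symm
      (perm_single_smul g a b x).symm

theorem FinGSet.perm_empty (Γ : Type u) [Group Γ] : (FinGSet.empty Γ).perm ≈ FGMod.zero Γ := by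
  have : Subsingleton (FinGSet.empty Γ).perm.carrier :=
    (MonoidAlgebra.coeffLinearEquiv (S := ℚ) (M := PEmpty.{u + 1}) ℚ).injective.subsingleton
  have : Subsingleton (FGMod.zero Γ).carrier := inferInstanceAs (Subsingleton PUnit)
  exact ⟨LinearEquiv.ofBijective (0 : _ →ₗ[MonoidAlgebra ℚ Γ] _)
    ⟨fun _ _ _ => Subsingleton.elim _ _, fun y => ⟨0, Subsingleton.elim _ _⟩⟩⟩

/-- The homomorphism of monoids `[X] ↦ [ℚ[X]]`. -/
noncomputable def permClass (Γ : Type u) [Group Γ] : GSetClass Γ →+ ModClass Γ where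
  toFun := Quotient.map FinGSet.perm fun _ _ h => FinGSet.perm_congr h
  map_zero' := Quotient.sound (FinGSet.perm_empty Γ)
  map_add' := by
    rintro ⟨X⟩ ⟨Y⟩
    exact Quotient.sound (FinGSet.perm_sum X Y)

/-- The map `f : A(Γ) → R(Γ)`, `[X] ↦ [ℚ[X]]`. -/
noncomputable def permMap (Γ : Type u) [Group Γ] : Burnside Γ →+ RatRep Γ :=
  grothendieckMap (permClass Γ)

/-- The Burnside kernel `N(Γ)`. -/
noncomputable def burnsideKernel (Γ : Type u) [Group Γ] : AddSubgroup (Burnside Γ) :=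
  (permMap Γ).ker

/-! ### The relative modules for `G × H` -/

section Relative

variable (G : Type u) (H : Type v) [Group G] [Group H]

variable {G H} in
/-- `H` acts freely on the `G × H`-set `X`. -/
def FinGSet.IsFree (X : FinGSet (G × H)) : Prop :=
  ∀ (h : H) (x : X.carrier), ((1, h) : G × H) • x = x → h = 1

/-- The inclusion of group algebras `ℚ[H] → ℚ[G × H]`. -/
noncomputable def inclAlg : MonoidAlgebra ℚ H →+* MonoidAlgebra ℚ (G × H) :=
  MonoidAlgebra.mapDomainRingHom ℚ (MonoidHom.inr G H)

variable {G H} in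
/-- The `ℚ[G × H]`-module `M` is free as a module over `ℚ[H]`. -/
def FGMod.IsFree (M : FGMod (G × H)) : Prop :=
  letI : Module (MonoidAlgebra ℚ H) M.carrier := Module.compHom M.carrier (inclAlg G H)
  Module.Free (MonoidAlgebra ℚ H) M.carrier

/-- The monoid of isomorphism classes of finite `H`-free `G × H`-sets. -/
def freeGSetClass : AddSubmonoid (GSetClass (G × H)) where
  carrier := {c | ∃ X : FinGSet (G × H), X.IsFree ∧ Quotient.mk _ X = c}
  zero_mem' := ⟨FinGSet.empty _, fun _ x => PEmpty.elim x, rfl⟩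
  add_mem' := by
    rintro _ _ ⟨X, hX, rfl⟩ ⟨Y, hY, rfl⟩
    refine ⟨X.sum Y, ?_, rfl⟩
    rintro h (x | x) hx
    · exact hX h x (Sum.inl_injective hx)
    · exact hY h x (Sum.inr_injective hx)

/-- The monoid of isomorphism classes of finitely generated `ℚ[H]`-free `ℚ[G × H]`-modules. -/
def freeModClass : AddSubmonoid (ModClass (G × H)) where
  carrier := {c | ∃ M : FGMod (G × H), M.IsFree ∧ Quotient.mk _ M = c}
  zero_mem' := by
    refine ⟨FGMod.zero _, ?_, rfl⟩
    letI : Module (MonoidAlgebra ℚ H) (FGMod.zero (G × H)).carrier :=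
      Module.compHom _ (inclAlg G H)
    have : Subsingleton (FGMod.zero (G × H)).carrier := inferInstanceAs (Subsingleton PUnit)
    exact Module.Free.of_subsingleton _ _
  add_mem' := by
    rintro _ _ ⟨M, hM, rfl⟩ ⟨N, hN, rfl⟩
    refine ⟨M.prod N, ?_, rfl⟩
    letI : Module (MonoidAlgebra ℚ H) M.carrier := Module.compHom _ (inclAlg G H)
    letI : Module (MonoidAlgebra ℚ H) N.carrier := Module.compHom _ (inclAlg G H)
    have : Module.Free (MonoidAlgebra ℚ H) M.carrier := hM
    have : Module.Free (MonoidAlgebra ℚ H) N.carrier := hN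
    exact Module.Free.prod (MonoidAlgebra ℚ H) M.carrier N.carrier

/-- The relative Burnside module `A(G,H)`. -/
abbrev RelA : Type (max u v + 1) := Algebra.GrothendieckAddGroup (freeGSetClass G H)

/-- The relative rational representation module `R(G,H)`. -/
abbrev RelR : Type (max u v + 1) := Algebra.GrothendieckAddGroup (freeModClass G H)

variable {G H} in
/-- The permutation module of an `H`-free set is `ℚ[H]`-free. -/
theorem FinGSet.IsFree.perm {X : FinGSet (G × H)} (hX : X.IsFree) : X.perm.IsFree := by
  classical
  letI : MulAction H X.carrier := MulAction.compHom X.carrier (MonoidHom.inr G H)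
  let V := (Representation.ofMulAction ℚ (G × H) X.carrier).asModule
  letI : Module (MonoidAlgebra ℚ H) V := Module.compHom V (inclAlg G H)
  change Module.Free (MonoidAlgebra ℚ H) V
  let Ω := Quotient (MulAction.orbitRel H X.carrier)
  have hb : Function.Bijective fun q : Ω × H => q.2 • q.1.out := by
    constructor
    · rintro ⟨o, h⟩ ⟨o', h'⟩ (e : h • o.out = h' • o'.out)
      have ho : o = o' := by
        rw [← Quotient.out_eq o, ← Quotient.out_eq o']
        apply Quotient.sound (s := MulAction.orbitRel H X.carrier)
        refine ⟨h⁻¹ * h', ?_⟩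
        change (h⁻¹ * h') • o'.out = o.out
        rw [mul_smul, ← e, inv_smul_smul]
      subst ho
      have : (h'⁻¹ * h) • o.out = o.out := by rw [mul_smul, e, inv_smul_smul]
      have := hX (h'⁻¹ * h) o.out this
      rw [inv_mul_eq_one] at this
      rw [this]
    · intro x
      obtain ⟨h, hh⟩ : (MulAction.orbitRel H X.carrier) x
          (Quotient.mk (MulAction.orbitRel H X.carrier) x).out :=
        (MulAction.orbitRel H X.carrier).symm
          (Quotient.mk_out (s := MulAction.orbitRel H X.carrier) x)
      exact ⟨(Quotient.mk _ x, h), hh⟩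
  let E : (Ω →₀ MonoidAlgebra ℚ H) ≃+ MonoidAlgebra ℚ X.carrier :=
    ((Finsupp.mapRange.linearEquiv (α := Ω) (MonoidAlgebra.coeffLinearEquiv (S := ℚ) (M := H) ℚ)).trans
      ((Finsupp.curryLinearEquiv ℚ).symm.trans
        ((Finsupp.domLCongr (Equiv.ofBijective _ hb)).trans
          (MonoidAlgebra.coeffLinearEquiv ℚ).symm))).toAddEquiv
  have hE : ∀ (o : Ω) (h : H) (a : ℚ),
      E (Finsupp.single o (single h a)) = single (h • o.out) a := by
    intro o h a
    simp [E]
  let S : Set (Ω →₀ MonoidAlgebra ℚ H) := {m | ∃ o h a, m = Finsupp.single o (single h a)}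
  have hS : AddSubmonoid.closure S = ⊤ := by
    refine top_unique fun m _ => ?_
    induction m using Finsupp.induction_linear with
    | zero => exact zero_mem _
    | add x y hx hy => exact add_mem (hx trivial) (hy trivial)
    | single o r =>
      induction r using MonoidAlgebra.induction_linear with
      | zero => rw [Finsupp.single_zero]; exact zero_mem _
      | add x y hx hy => rw [Finsupp.single_add]; exact add_mem (hx trivial) (hy trivial)
      | single h a => exact AddSubmonoid.subset_closure ⟨o, h, a, rfl⟩
  refine Module.Free.of_equiv
    (linearEquivOfMonomial (M := Ω →₀ MonoidAlgebra ℚ H) (N := V) E S hS ?_)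
  rintro h a _ ⟨o, h', b, rfl⟩
  rw [Finsupp.smul_single, smul_eq_mul, MonoidAlgebra.single_mul_single]
  erw [hE, hE]
  have h1 : inclAlg G H (single h a) = single ((1, h) : G × H) a := by simp [inclAlg]
  have h2 := perm_single_smul ((1, h) : G × H) a b (h' • o.out)
  rw [← h1] at h2
  rw [mul_smul]
  exact h2.symm

/-- The homomorphism of monoids `[X] ↦ [ℚ[X]]` on `H`-free sets. -/
noncomputable def relPermClass : freeGSetClass G H →+ freeModClass G H :=
  ((permClass (G × H)).comp (freeGSetClass G H).subtype).codRestrict (freeModClass G H) <| by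
    rintro ⟨_, X, hX, rfl⟩
    exact ⟨X.perm, hX.perm, rfl⟩

/-- The map `f' : A(G,H) → R(G,H)`, `[X] ↦ [ℚ[X]]`. -/
noncomputable def relPermMap : RelA G H →+ RelR G H :=
  grothendieckMap (relPermClass G H)

/-- The relative Burnside kernel `N(G,H)`. -/
noncomputable def relBurnsideKernel : AddSubgroup (RelA G H) := (relPermMap G H).ker

/-- The inclusion `A(G,H) ⊆ A(G × H)`. -/
noncomputable def relIncl : RelA G H →+ Burnside (G × H) :=
  grothendieckMap (freeGSetClass G H).subtype

end Relative

/-! ### Induction from subquotients -/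

section Induction

variable {Γ : Type u} [Group Γ] (L : Subgroup Γ) (C : Subgroup L) [C.Normal]

/-- The relation `(g l, x) ∼ (g, l x)` on `Γ × X`, for an `L/C`-set `X` seen as an `L`-set. -/
def indSetoid (X : Type u) [MulAction (L ⧸ C) X] : Setoid (Γ × X) where
  r a b := ∃ l : L, a.1 = b.1 * l ∧ b.2 = (l : L ⧸ C) • a.2
  iseqv :=
    { refl := fun a => ⟨1, by simp, by simp⟩
      symm := by
        rintro a b ⟨l, h1, h2⟩
        exact ⟨l⁻¹, by simp [h1], by simp [h2]⟩
      trans := by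
        rintro a b c ⟨l, h1, h2⟩ ⟨l', h1', h2'⟩
        exact ⟨l' * l, by simp [h1, h1', mul_assoc], by simp [h2, h2', mul_smul]⟩ }

/-- The action of `Γ` on `Γ ×_L X` by left multiplication. -/
instance indAction (X : Type u) [MulAction (L ⧸ C) X] :
    MulAction Γ (Quotient (indSetoid L C X)) where
  smul g := Quotient.map (fun a => (g * a.1, a.2)) fun a b ⟨l, h1, h2⟩ =>
    ⟨l, by simp [h1, mul_assoc], h2⟩
  one_smul := by
    rintro ⟨a⟩
    exact congrArg (Quotient.mk _) (Prod.ext (one_mul _) rfl)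
  mul_smul := by
    rintro g h ⟨a⟩
    exact congrArg (Quotient.mk _) (Prod.ext (mul_assoc _ _ _) rfl)

variable [Finite Γ]

/-- The induced `Γ`-set `Γ ×_L X` of an `L/C`-set `X`. -/
def FinGSet.ind (X : FinGSet (L ⧸ C)) : FinGSet Γ where
  carrier := Quotient (indSetoid L C X.carrier)

theorem FinGSet.ind_congr {X Y : FinGSet (L ⧸ C)} (h : X ≈ Y) : X.ind L C ≈ Y.ind L C := by
  obtain ⟨e, he⟩ := h
  refine ⟨Quotient.congr ((Equiv.refl Γ).prodCongr e) ?_, ?_⟩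
  · rintro ⟨g, x⟩ ⟨g', x'⟩
    constructor
    · rintro ⟨l, h1, h2⟩
      exact ⟨l, h1, (congrArg e h2).trans (he _ _)⟩
    · rintro ⟨l, h1, h2⟩
      exact ⟨l, h1, e.injective (h2.trans (he _ _).symm)⟩
  · rintro g ⟨a⟩
    rfl

theorem FinGSet.ind_sum (X Y : FinGSet (L ⧸ C)) :
    (X.sum Y).ind L C ≈ (X.ind L C).sum (Y.ind L C) := by
  let F : ((X.sum Y).ind L C).carrier → ((X.ind L C).sum (Y.ind L C)).carrier :=
    Quotient.lift (fun a : Γ × (X.carrier ⊕ Y.carrier) =>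
      (Sum.map (fun x => (Quotient.mk (indSetoid L C X.carrier) (a.1, x)))
        (fun y => (Quotient.mk (indSetoid L C Y.carrier) (a.1, y))) a.2 :
        Quotient (indSetoid L C X.carrier) ⊕ Quotient (indSetoid L C Y.carrier))) <| by
      rintro ⟨g, x | y⟩ ⟨g', x' | y'⟩ ⟨l, h1, h2⟩
      · exact congrArg Sum.inl (Quotient.sound ⟨l, h1, Sum.inl_injective h2⟩)
      · cases h2
      · cases h2
      · exact congrArg Sum.inr (Quotient.sound ⟨l, h1, Sum.inr_injective h2⟩)
  have hF : Function.Bijective F := by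
    constructor
    · rintro ⟨g, x | y⟩ ⟨g', x' | y'⟩ h
      · obtain ⟨l, h1, h2⟩ := Quotient.exact (Sum.inl_injective h)
        exact Quotient.sound ⟨l, h1, congrArg Sum.inl h2⟩
      · cases h
      · cases h
      · obtain ⟨l, h1, h2⟩ := Quotient.exact (Sum.inr_injective h)
        exact Quotient.sound ⟨l, h1, congrArg Sum.inr h2⟩
    · rintro (⟨g, x⟩ | ⟨g, y⟩)
      · exact ⟨Quotient.mk _ (g, Sum.inl x), rfl⟩
      · exact ⟨Quotient.mk _ (g, Sum.inr y), rfl⟩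
  refine ⟨Equiv.ofBijective F hF, ?_⟩
  rintro g ⟨g', x | y⟩ <;> rfl

theorem FinGSet.ind_empty : (FinGSet.empty (L ⧸ C)).ind L C ≈ FinGSet.empty Γ := by
  have : IsEmpty ((FinGSet.empty (L ⧸ C)).ind L C).carrier :=
    ⟨by rintro ⟨_, x⟩; exact PEmpty.elim x⟩
  have : IsEmpty (FinGSet.empty Γ).carrier := inferInstanceAs (IsEmpty PEmpty)
  exact ⟨Equiv.equivOfIsEmpty _ _, fun _ x => isEmptyElim x⟩

/-- The homomorphism of monoids `[X] ↦ [Γ ×_L X]`. -/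
noncomputable def indClass : GSetClass (L ⧸ C) →+ GSetClass Γ where
  toFun := Quotient.map (FinGSet.ind L C) fun _ _ h => FinGSet.ind_congr L C h
  map_zero' := Quotient.sound (FinGSet.ind_empty L C)
  map_add' := by
    rintro ⟨X⟩ ⟨Y⟩
    exact Quotient.sound (FinGSet.ind_sum L C X Y)

/-- The induction map `L/C↑ : A(L/C) → A(Γ)`. -/
noncomputable def indMap : Burnside (L ⧸ C) →+ Burnside Γ := grothendieckMap (indClass L C)

end Induction

/-! ### The conjectural description of the relative Burnside kernel -/

section Conjecture

variable (G : Type u) (H : Type v) [Group G] [Group H]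

/-- The subgroup `Ã(L/C)` of those elements of `A(L/C)` whose induction lies in `A(G,H)`. -/
noncomputable def tildeBurnside [Finite G] [Finite H] (L : Subgroup (G × H)) (C : Subgroup L)
    [C.Normal] : AddSubgroup (Burnside (L ⧸ C)) :=
  (relIncl G H).range.comap (indMap L C)

/-- `Ñ(L/C) = N(L/C) ∩ Ã(L/C)`. -/
noncomputable def tildeKernel [Finite G] [Finite H] (L : Subgroup (G × H)) (C : Subgroup L)
    [C.Normal] : AddSubgroup (Burnside (L ⧸ C)) :=
  burnsideKernel (L ⧸ C) ⊓ tildeBurnside G H L C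

/-- `T` is `ℤ/p × ℤ/p`, or dihedral of order `2 ^ (m + 1) ≥ 8` (with `p = 2`), or nonabelian of
order `p ^ 3` and exponent `p`. -/
def IsBasicType (p : ℕ) (T : Type*) [Group T] : Prop :=
  Nonempty (T ≃* Multiplicative (ZMod p) × Multiplicative (ZMod p)) ∨
  (p = 2 ∧ ∃ m : ℕ, 2 ≤ m ∧ Nonempty (T ≃* DihedralGroup (2 ^ m))) ∨
  (Nat.card T = p ^ 3 ∧ Monoid.exponent T = p ∧ ∃ a b : T, a * b ≠ b * a)

/-- `Q` is isomorphic to `T × H` for a group `T` of one of the three basic types. -/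
def IsBasicSubquotient (p : ℕ) (Q : Type*) [Group Q] : Prop :=
  ∃ (T : Type) (_ : Group T), IsBasicType p T ∧ Nonempty (Q ≃* T × H)

/-- The equality `N(G,H) = ∑ L/C↑ Ñ(L/C)` of subgroups of `A(G × H)`, the sum being over the
subquotients `L/C` of `G × H` isomorphic to `T × H` with `T` of one of the three basic types. -/
def KernelIsInduced (p : ℕ) [Finite G] [Finite H] : Prop :=
  (relBurnsideKernel G H).map (relIncl G H) =
    ⨆ (L : Subgroup (G × H)) (C : Subgroup L) (_ : C.Normal)
      (_ : IsBasicSubquotient H p (L ⧸ C)), (tildeKernel G H L C).map (indMap L C)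

end Conjecture

end RelBurnside

/-! Write Γ = G × H, an abelian group. Splitting a set into orbits shows that A(G,H) is spanned by
the classes of Γ/L with L ∩ (1 × H) = 1. Projection to G embeds such an L in G, so L is cyclic. The
character of ℚ[Γ/L] at g is [Γ : L] if g ∈ L and 0 otherwise. Hence evaluating a combination at a
generator of a maximal subgroup in its support isolates one coefficient
(`eq_zero_of_ratTrace_cosetMap`). This triangularity gives both the basis of A(G,H) and the
injectivity of f'.

For surjectivity, R(Γ) is generated by permutation modules: a simple ℚ[Γ]-module is determined by
its kernel, because cyclotomic polynomials are irreducible over ℚ, and ℚ[Γ/K] is the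
multiplicity-free sum of the simple modules whose kernel contains K (`of_cls_mem_closure_coset`). As
|H| = p is prime, a subgroup that is not free in the above sense has the form P × H. The rank-two
elementary abelian relation (`perm_relation`) replaces ⟨g^p⟩ × H by p times ⟨g⟩ × H modulo the image
of f'. So R(Γ) is the image of f' plus the multiples of the trivial module. The trace of (1,h) with
h ≠ 1 vanishes on H-free modules and is 1 on the trivial module, so an H-free class involves no
trivial part. One descends to R(G,H) because R(G,H) → R(Γ) is injective (`relRatIncl_injective`).

The rank is a count of subgroups (`card_freeSubgroup`). The sum over subquotients is empty, since Γ
is abelian and has no elementary abelian subquotient of rank three (`not_isBasicSubquotient`). -/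

namespace RelBurnside

open MonoidAlgebra Algebra

/-! ### Grothendieck groups -/

theorem exists_of_sub_of {M : Type*} [AddCommMonoid M] (x : GrothendieckAddGroup M) :
    ∃ a b : M, x = GrothendieckAddGroup.of a - GrothendieckAddGroup.of b := by
  induction x using AddLocalization.ind with
  | _ y =>
    obtain ⟨a, b⟩ := y
    refine ⟨a, b, ?_⟩
    rw [AddLocalization.mk_eq_addMonoidOf_mk', eq_sub_iff_add_eq]
    exact (AddLocalization.addMonoidOf ⊤).mk'_spec a b

theorem of_eq_of_iff {M : Type*} [AddCommMonoid M] {a b : M} :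
    GrothendieckAddGroup.of a = GrothendieckAddGroup.of b ↔ ∃ c, c + a = c + b := by
  refine ((AddLocalization.addMonoidOf ⊤).eq_iff_exists).trans ?_
  simp

@[simp]
theorem grothendieckMap_of {M N : Type*} [AddCommMonoid M] [AddCommMonoid N] (φ : M →+ N) (a : M) :
    grothendieckMap φ (GrothendieckAddGroup.of a) = GrothendieckAddGroup.of (φ a) := by
  exact DFunLike.congr_fun
    (GrothendieckAddGroup.lift.symm_apply_apply (GrothendieckAddGroup.of.comp φ)) a

theorem lift_of {M A : Type*} [AddCommMonoid M] [AddCommGroup A] (φ : M →+ A) (a : M) :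
    GrothendieckAddGroup.lift φ (GrothendieckAddGroup.of a) = φ a :=
  DFunLike.congr_fun (GrothendieckAddGroup.lift.symm_apply_apply φ) a

/-! ### Classes of modules -/

section Modules

variable {Γ : Type u} [Group Γ]

/-- The isomorphism class of a finitely generated module. -/
def FGMod.cls (M : FGMod Γ) : ModClass Γ := Quotient.mk _ M

/-- The isomorphism class of a finite set with a group action. -/
def FinGSet.cls (X : FinGSet Γ) : GSetClass Γ := Quotient.mk _ X

theorem FGMod.cls_eq {M N : FGMod Γ} (e : M.carrier ≃ₗ[MonoidAlgebra ℚ Γ] N.carrier) :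
    M.cls = N.cls := Quotient.sound ⟨e⟩

theorem FGMod.cls_eq_add {M N P : FGMod Γ}
    (e : M.carrier ≃ₗ[MonoidAlgebra ℚ Γ] N.carrier × P.carrier) : M.cls = N.cls + P.cls :=
  Quotient.sound ⟨e⟩

theorem FGMod.cls_eq_zero (M : FGMod Γ) [Subsingleton M.carrier] : M.cls = 0 :=
  Quotient.sound ⟨(LinearEquiv.ofSubsingleton M.carrier PUnit.{u + 1} :
    M.carrier ≃ₗ[MonoidAlgebra ℚ Γ] PUnit.{u + 1})⟩

theorem FGMod.cls_eq_sum {ι : Type*} [Fintype ι] (M : FGMod Γ) (N : ι → FGMod Γ)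
    (e : M.carrier ≃ₗ[MonoidAlgebra ℚ Γ] (∀ i, (N i).carrier)) : M.cls = ∑ i, (N i).cls := by
  suffices h : ∀ [Fintype ι] (M : FGMod Γ) (N : ι → FGMod Γ)
      (_ : M.carrier ≃ₗ[MonoidAlgebra ℚ Γ] (∀ i, (N i).carrier)), M.cls = ∑ i, (N i).cls from
    h M N e
  clear e M N
  induction ι using Finite.induction_empty_option with
  | of_equiv f ih =>
    intro _ M N e
    have := Fintype.ofEquiv _ f.symm
    rw [ih M (fun a => N (f a))
      (e.trans (LinearEquiv.piCongrLeft (MonoidAlgebra ℚ Γ) (fun i => (N i).carrier) f).symm)]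
    exact f.sum_comp fun i => (N i).cls
  | h_empty =>
    intro _ M N e
    have := e.toEquiv.subsingleton
    simpa using M.cls_eq_zero
  | h_option ih =>
    intro _ M N e
    let f := e.trans (LinearEquiv.piOptionEquivProd (MonoidAlgebra ℚ Γ))
    -- The remaining factors are realised as a submodule of `M`, not as the product itself: the
    -- product may live in too large a universe to carry an `FGMod Γ`.
    let φ := f.symm.toLinearMap ∘ₗ
      LinearMap.inr (MonoidAlgebra ℚ Γ) (N none).carrier (∀ i, (N (some i)).carrier)
    let g := LinearEquiv.ofInjective φ (f.symm.injective.comp LinearMap.inr_injective)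
    let P : FGMod Γ := ⟨LinearMap.range φ⟩
    have hP := ih P _ g.symm
    have h : M.cls = (N none).cls + P.cls :=
      FGMod.cls_eq_add (f.trans ((LinearEquiv.refl _ _).prodCongr g))
    rw [h, hP]
    convert! (Fintype.sum_option fun i => (N i).cls).symm

end Modules

/-! ### Semisimplicity of ℚ[Γ] for a finite abelian group -/

section Commutative

variable {Γ : Type u} [CommGroup Γ] [Finite Γ]

/-- Maschke's theorem: the order of Γ is nonzero in ℚ. -/
instance : IsSemisimpleRing (MonoidAlgebra ℚ Γ) := by
  have : NeZero (Nat.card Γ : ℚ) := ⟨by simp [Nat.card_pos.ne']⟩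
  infer_instance

/-- The cyclic module `ℚ[Γ] / I`. -/
noncomputable def FGMod.quot (I : Ideal (MonoidAlgebra ℚ Γ)) : FGMod Γ where
  carrier := MonoidAlgebra ℚ Γ ⧸ I

theorem FGMod.exists_cls_eq_sum (M : FGMod Γ) :
    ∃ (n : ℕ) (m : Fin n → MaximalSpectrum (MonoidAlgebra ℚ Γ)),
      M.cls = ∑ i, (FGMod.quot (m i).asIdeal).cls := by
  obtain ⟨n, S, e, hS⟩ :=
    IsSemisimpleModule.exists_linearEquiv_fin_dfinsupp (MonoidAlgebra ℚ Γ) M.carrier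
  have h := fun i => isSimpleModule_iff_quot_maximal.1 (hS i)
  choose I hI hI' using h
  refine ⟨n, fun i => ⟨I i, hI i⟩, FGMod.cls_eq_sum M _ ?_⟩
  exact e.trans ((DFinsupp.linearEquivFunOnFintype (R := MonoidAlgebra ℚ Γ)).trans
    (LinearEquiv.piCongrRight fun i => (hI' i).some))

/-- By semisimplicity the ideal (r) is generated by an idempotent f. If f ∉ I, then I + (1 - f) is
proper, and a maximal ideal above it that contained r would contain both f and 1 - f. -/
theorem eq_iInf_maximal (I : Ideal (MonoidAlgebra ℚ Γ)) :
    I = ⨅ m : {m : MaximalSpectrum (MonoidAlgebra ℚ Γ) // I ≤ m.asIdeal}, m.1.asIdeal := by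
  refine le_antisymm (le_iInf fun m => m.2) ?_
  intro r hr
  obtain ⟨f, hf, hrf⟩ := IsSemisimpleRing.ideal_eq_span_idempotent (Ideal.span {r})
  have hfr : f ∈ Ideal.span {r} := hrf ▸ Ideal.mem_span_singleton_self f
  suffices f ∈ I from
    (Ideal.span_singleton_le_iff_mem I).2 this (hrf ▸ Ideal.mem_span_singleton_self r)
  by_contra hfI
  have hJ : I ⊔ Ideal.span {1 - f} ≠ ⊤ := by
    intro h
    obtain ⟨i, hi, y, hy, hiy⟩ := Submodule.mem_sup.1 ((Ideal.eq_top_iff_one _).1 h)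
    obtain ⟨a, rfl⟩ := Ideal.mem_span_singleton.1 hy
    refine hfI ?_
    have : f = f * i := by
      have h1 : f * f = f := hf
      linear_combination (-f) * hiy - a * h1
    rw [this]
    exact I.mul_mem_left _ hi
  obtain ⟨m, hm, hle⟩ := Ideal.exists_le_maximal _ hJ
  have h1 : r ∈ m := (iInf_le (fun m : {m : MaximalSpectrum (MonoidAlgebra ℚ Γ) // I ≤ m.asIdeal} =>
    m.1.asIdeal) ⟨⟨m, hm⟩, le_sup_left.trans hle⟩) hr
  have h2 : f ∈ m := (Ideal.span_singleton_le_iff_mem m).2 h1 hfr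
  have h3 : 1 - f ∈ m := hle (Ideal.mem_sup_right (Ideal.mem_span_singleton_self _))
  exact hm.ne_top ((Ideal.eq_top_iff_one m).2 (by simpa using m.add_mem h2 h3))

/-- The Chinese remainder decomposition of a cyclic module into simple modules. -/
noncomputable def quotEquivPi (I : Ideal (MonoidAlgebra ℚ Γ)) :
    (MonoidAlgebra ℚ Γ ⧸ I) ≃ₗ[MonoidAlgebra ℚ Γ]
      (∀ m : {m : MaximalSpectrum (MonoidAlgebra ℚ Γ) // I ≤ m.asIdeal},
        MonoidAlgebra ℚ Γ ⧸ m.1.asIdeal) :=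
  (Submodule.quotEquivOfEq _ _ (by
    conv_lhs => rw [eq_iInf_maximal I]
    rw [LinearMap.ker_pi]
    simp)).trans
  ((LinearMap.pi fun m : {m : MaximalSpectrum (MonoidAlgebra ℚ Γ) // I ≤ m.asIdeal} =>
    m.1.asIdeal.mkQ).quotKerEquivOfSurjective <|
      Ideal.pi_mkQ_surjective fun m m' h =>
        Ideal.isCoprime_of_isMaximal fun h' => h (Subtype.ext (MaximalSpectrum.ext h')))

-- By the Chinese remainder theorem each simple module occurs at most once. The indicator form
-- allows identities between cyclic modules to be checked one maximal ideal at a time.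
open Classical in
theorem FGMod.quot_cls [Fintype (MaximalSpectrum (MonoidAlgebra ℚ Γ))]
    (I : Ideal (MonoidAlgebra ℚ Γ)) :
    (FGMod.quot I).cls = ∑ m : MaximalSpectrum (MonoidAlgebra ℚ Γ),
      if I ≤ m.asIdeal then (FGMod.quot m.asIdeal).cls else 0 := by
  rw [← Finset.sum_filter, Finset.sum_subtype (Finset.univ.filter fun m => I ≤ m.asIdeal)
    (p := fun m : MaximalSpectrum (MonoidAlgebra ℚ Γ) => I ≤ m.asIdeal) (by simp)
    fun m => (FGMod.quot m.asIdeal).cls]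
  let N : {m : MaximalSpectrum (MonoidAlgebra ℚ Γ) // I ≤ m.asIdeal} → FGMod Γ :=
    fun m => FGMod.quot m.1.asIdeal
  have e : (FGMod.quot I).carrier ≃ₗ[MonoidAlgebra ℚ Γ] (∀ m, (N m).carrier) := quotEquivPi I
  exact FGMod.cls_eq_sum _ N e

end Commutative
/-! ### Permutation modules -/

section PermutationModules

variable {Γ : Type u} [Group Γ]

/-- The element `a x` of the permutation module `ℚ[X]`. -/
noncomputable def FinGSet.permSingle (X : FinGSet Γ) (x : X.carrier) (a : ℚ) : X.perm.carrier :=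
  (single x a : MonoidAlgebra ℚ X.carrier)

theorem FinGSet.single_smul_permSingle (X : FinGSet Γ) (g : Γ) (x : X.carrier) (a b : ℚ) :
    (single g a : MonoidAlgebra ℚ Γ) • X.permSingle x b = X.permSingle (g • x) (a * b) :=
  perm_single_smul g a b x

theorem FinGSet.perm_induction {X : FinGSet Γ} {P : X.perm.carrier → Prop} (m : X.perm.carrier)
    (zero : P 0) (add : ∀ x y, P x → P y → P (x + y)) (single : ∀ x a, P (X.permSingle x a)) :
    P m :=
  MonoidAlgebra.induction_linear (motive := P) m zero add single

/-- Additive maps out of a permutation module. -/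
noncomputable def FinGSet.permLift (X : FinGSet Γ) {A : Type*} [AddCommGroup A]
    (φ : X.carrier → ℚ →+ A) : X.perm.carrier →+ A :=
  (Finsupp.liftAddHom φ).comp (coeffAddEquiv (R := ℚ) (M := X.carrier)).toAddMonoidHom

theorem FinGSet.permLift_permSingle (X : FinGSet Γ) {A : Type*} [AddCommGroup A]
    (φ : X.carrier → ℚ →+ A) (x : X.carrier) (a : ℚ) : X.permLift φ (X.permSingle x a) = φ x a :=
  Finsupp.liftAddHom_apply_single φ x a

variable [Finite Γ]

/-- The transitive `Γ`-set `Γ / L`. -/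
def FinGSet.coset (L : Subgroup Γ) : FinGSet Γ where
  carrier := Γ ⧸ L

end PermutationModules

/-! ### Permutation modules ℚ[Γ/L] of an abelian group as cyclic modules -/

section Commutative

variable {Γ : Type u} [CommGroup Γ]

/-- The homomorphism from `Γ` to the units of a quotient of its group algebra. -/
noncomputable def quotChar (m : Ideal (MonoidAlgebra ℚ Γ)) : Γ →* MonoidAlgebra ℚ Γ ⧸ m :=
  (Ideal.Quotient.mk m).toMonoidHom.comp (MonoidAlgebra.of ℚ Γ)

theorem quotChar_apply (m : Ideal (MonoidAlgebra ℚ Γ)) (g : Γ) :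
    quotChar m g = Ideal.Quotient.mk m (single g 1) := rfl

theorem mk_single (m : Ideal (MonoidAlgebra ℚ Γ)) (g : Γ) (a : ℚ) :
    Ideal.Quotient.mk m (single g a) = algebraMap ℚ _ a * quotChar m g := by
  rw [quotChar_apply, ← mul_one a, ← smul_eq_mul, ← smul_single, Algebra.smul_def, map_mul]
  simp
  rfl

variable [Finite Γ]

/-- The annihilator of the generator of `ℚ[Γ / L]`. -/
noncomputable def cosetIdeal (L : Subgroup Γ) : Ideal (MonoidAlgebra ℚ Γ) :=
  LinearMap.ker (LinearMap.toSpanSingleton (MonoidAlgebra ℚ Γ) (FinGSet.coset L).perm.carrier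
    ((FinGSet.coset L).permSingle ((1 : Γ) : Γ ⧸ L) 1))

theorem mem_cosetIdeal {L : Subgroup Γ} {r : MonoidAlgebra ℚ Γ} :
    r ∈ cosetIdeal L ↔ r • (FinGSet.coset L).permSingle ((1 : Γ) : Γ ⧸ L) 1 = 0 := Iff.rfl

theorem single_smul_coset (L : Subgroup Γ) (g : Γ) (a : ℚ) :
    (single g a : MonoidAlgebra ℚ Γ) • (FinGSet.coset L).permSingle ((1 : Γ) : Γ ⧸ L) 1 =
      (FinGSet.coset L).permSingle (g : Γ ⧸ L) a := by
  refine ((FinGSet.coset L).single_smul_permSingle _ _ _ _).trans ?_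
  rw [mul_one]
  exact congrArg (fun x => (FinGSet.coset L).permSingle x a)
    (congrArg (QuotientGroup.mk (s := L)) (mul_one g))

theorem FinGSet.coset_perm_cls (L : Subgroup Γ) :
    (FinGSet.coset L).perm.cls = (FGMod.quot (cosetIdeal L)).cls := by
  refine (FGMod.cls_eq (LinearMap.quotKerEquivOfSurjective (LinearMap.toSpanSingleton
    (MonoidAlgebra ℚ Γ) (FinGSet.coset L).perm.carrier
    ((FinGSet.coset L).permSingle ((1 : Γ) : Γ ⧸ L) 1)) fun y => ?_)).symm
  induction y using FinGSet.perm_induction with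
  | zero => exact ⟨0, map_zero _⟩
  | add x y hx hy =>
    obtain ⟨r, rfl⟩ := hx
    obtain ⟨s, rfl⟩ := hy
    exact ⟨r + s, map_add _ _ _⟩
  | single x a =>
    induction x using QuotientGroup.induction_on with
    | H g => exact ⟨single g a, single_smul_coset L g a⟩

/-- For l ∈ L, the element l - 1 annihilates the trivial coset. Conversely, if L acts trivially on
ℚ[Γ]/m, then Γ → ℚ[Γ]/m factors through Γ/L, and its additive extension to ℚ[Γ/L] sends r · [L] to r
mod m. -/
theorem cosetIdeal_le_iff (L : Subgroup Γ) (m : Ideal (MonoidAlgebra ℚ Γ)) :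
    cosetIdeal L ≤ m ↔ L ≤ (quotChar m).ker := by
  constructor
  · intro h l hl
    rw [MonoidHom.mem_ker, ← map_one (quotChar m), quotChar_apply, quotChar_apply,
      Ideal.Quotient.eq]
    refine h ?_
    rw [mem_cosetIdeal, sub_smul, single_smul_coset, single_smul_coset, sub_eq_zero]
    congr 1
    exact QuotientGroup.eq.2 (by simpa using hl)
  · intro h r hr
    let φ : Γ ⧸ L →* MonoidAlgebra ℚ Γ ⧸ m := QuotientGroup.lift L (quotChar m) h
    let ψ := (FinGSet.coset L).permLift (fun x : Γ ⧸ L =>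
      (AddMonoidHom.mulRight (φ x)).comp (algebraMap ℚ (MonoidAlgebra ℚ Γ ⧸ m)).toAddMonoidHom)
    have hψ : ∀ r : MonoidAlgebra ℚ Γ,
        ψ (r • (FinGSet.coset L).permSingle ((1 : Γ) : Γ ⧸ L) 1) = Ideal.Quotient.mk m r := by
      intro r
      induction r using MonoidAlgebra.induction_linear with
      | zero => simp
      | add x y hx hy => rw [add_smul, map_add, hx, hy, map_add]
      | single g a =>
        rw [single_smul_coset, mk_single]
        exact FinGSet.permLift_permSingle _ _ _ _
    rw [← Ideal.Quotient.eq_zero_iff_mem, ← hψ, mem_cosetIdeal.1 hr, map_zero]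

open Classical in
theorem FinGSet.coset_perm_cls_eq_sum [Fintype (MaximalSpectrum (MonoidAlgebra ℚ Γ))]
    (L : Subgroup Γ) : (FinGSet.coset L).perm.cls = ∑ m : MaximalSpectrum (MonoidAlgebra ℚ Γ),
      if L ≤ (quotChar m.asIdeal).ker then (FGMod.quot m.asIdeal).cls else 0 := by
  rw [FinGSet.coset_perm_cls, FGMod.quot_cls]
  simp only [cosetIdeal_le_iff]

/-! ### Simple modules are determined by their kernels -/

/-- As g generates Γ modulo K, the ring ℚ[Γ/K] is generated by g over ℚ. -/
theorem exists_aeval_sub_mem_cosetIdeal {K : Subgroup Γ} {g : Γ}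
    (hg : ∀ x : Γ, ∃ n : ℕ, x * (g ^ n)⁻¹ ∈ K) (r : MonoidAlgebra ℚ Γ) :
    ∃ P : Polynomial ℚ, r - Polynomial.aeval (single g 1 : MonoidAlgebra ℚ Γ) P ∈ cosetIdeal K := by
  induction r using MonoidAlgebra.induction_linear with
  | zero => exact ⟨0, by simp⟩
  | add x y hx hy =>
    obtain ⟨P, hP⟩ := hx
    obtain ⟨Q, hQ⟩ := hy
    exact ⟨P + Q, by simpa [add_sub_add_comm] using add_mem hP hQ⟩
  | single x a =>
    obtain ⟨n, hn⟩ := hg x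
    refine ⟨Polynomial.monomial n a, ?_⟩
    rw [Polynomial.aeval_monomial, mem_cosetIdeal, sub_smul, sub_eq_zero, ← Algebra.smul_def,
      single_pow, one_pow, smul_single, smul_eq_mul, mul_one, single_smul_coset, single_smul_coset]
    congr 1
    refine (QuotientGroup.eq.2 ?_).symm
    rwa [mul_comm]

/-- Both elements have the cyclotomic polynomial of their common order as minimal polynomial. This
is where the rationality of the base field enters. -/
theorem aeval_eq_zero_of_orderOf_eq {F F' : Type*} [Field F] [Field F'] [Algebra ℚ F] [Algebra ℚ F']
    {ζ : F} {ζ' : F'} (h : orderOf ζ = orderOf ζ') (h0 : 0 < orderOf ζ) {P : Polynomial ℚ}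
    (hP : Polynomial.aeval ζ P = 0) : Polynomial.aeval ζ' P = 0 := by
  have := algebraRat.charZero F
  have := algebraRat.charZero F'
  have h1 := Polynomial.cyclotomic_eq_minpoly_rat (IsPrimitiveRoot.orderOf ζ) h0
  have h2 := Polynomial.cyclotomic_eq_minpoly_rat (IsPrimitiveRoot.orderOf ζ') (h ▸ h0)
  rw [h] at h1
  have h3 : minpoly ℚ ζ = minpoly ℚ ζ' := by
    convert! h1.symm.trans h2 <;> exact Subsingleton.elim _ _
  obtain ⟨Q, rfl⟩ := minpoly.dvd ℚ ζ hP
  rw [h3, map_mul, minpoly.aeval, zero_mul]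

/-- The image of Γ is a finite subgroup of the units of a field, hence cyclic. -/
theorem exists_generator_mod_ker (m : Ideal (MonoidAlgebra ℚ Γ)) [m.IsMaximal] :
    ∃ g : Γ, ∀ x : Γ, ∃ n : ℕ, quotChar m x = quotChar m g ^ n := by
  let χ := (quotChar m).toHomUnits
  have : Finite χ.range := Finite.of_surjective χ.rangeRestrict χ.rangeRestrict_surjective
  obtain ⟨⟨_, g, rfl⟩, hg⟩ := IsCyclic.exists_monoid_generator (α := χ.range)
  refine ⟨g, fun x => ?_⟩
  obtain ⟨n, hn⟩ := hg ⟨χ x, x, rfl⟩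
  exact ⟨n, (congrArg (fun y : χ.range => ((y : (MonoidAlgebra ℚ Γ ⧸ m)ˣ) :
    MonoidAlgebra ℚ Γ ⧸ m)) hn).symm⟩

/-- Let g generate Γ modulo the common kernel. Any r is a polynomial P in g modulo an ideal
contained in both m and m', so membership of r in either is the vanishing of P at the image of g.
The two images have the same order, as the kernels agree. -/
theorem maximal_le_of_ker_eq (m m' : Ideal (MonoidAlgebra ℚ Γ)) [m.IsMaximal] [m'.IsMaximal]
    (h : (quotChar m).ker = (quotChar m').ker) : m ≤ m' := by
  let := Ideal.Quotient.field m
  let := Ideal.Quotient.field m'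
  obtain ⟨g, hg⟩ := exists_generator_mod_ker m
  have hg' : ∀ x : Γ, ∃ n : ℕ, x * (g ^ n)⁻¹ ∈ (quotChar m).ker := by
    intro x
    obtain ⟨n, hn⟩ := hg x
    refine ⟨n, ?_⟩
    rw [MonoidHom.mem_ker, map_mul, hn, ← map_pow, ← map_mul, mul_inv_cancel, map_one]
  have hord : orderOf (quotChar m g) = orderOf (quotChar m' g) := by
    rw [orderOf_eq_orderOf_iff]
    intro n
    rw [← map_pow, ← map_pow, ← MonoidHom.mem_ker, ← MonoidHom.mem_ker, h]
  have hpos : 0 < orderOf (quotChar m g) :=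
    orderOf_pos_iff.2 ((quotChar m).isOfFinOrder (isOfFinOrder_of_finite g))
  intro r hr
  obtain ⟨P, hP⟩ := exists_aeval_sub_mem_cosetIdeal hg' r
  have h1 : ∀ n : Ideal (MonoidAlgebra ℚ Γ), (quotChar m).ker ≤ (quotChar n).ker →
      (r ∈ n ↔ Polynomial.aeval (quotChar n g) P = 0) := by
    intro n hn
    have h2 := (cosetIdeal_le_iff _ _).2 hn hP
    rw [← Ideal.Quotient.eq_zero_iff_mem, Ideal.Quotient.eq.2 h2]
    rw [quotChar_apply, ← Ideal.Quotient.mkₐ_eq_mk ℚ, Polynomial.aeval_algHom_apply]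
  exact (h1 m' h.le).2 (aeval_eq_zero_of_orderOf_eq hord hpos ((h1 m le_rfl).1 hr))

theorem maximal_eq_of_ker_eq {m m' : MaximalSpectrum (MonoidAlgebra ℚ Γ)}
    (h : (quotChar m.asIdeal).ker = (quotChar m'.asIdeal).ker) : m = m' :=
  have := m.isMaximal
  have := m'.isMaximal
  MaximalSpectrum.ext (le_antisymm (maximal_le_of_ker_eq _ _ h) (maximal_le_of_ker_eq _ _ h.symm))

/-- Downward induction on the kernel K of a simple module: ℚ[Γ/K] is that module plus simple modules
with strictly larger kernel, strictness because the kernel determines the module. -/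
theorem of_cls_mem_closure_coset (M : FGMod Γ) :
    (GrothendieckAddGroup.of M.cls : RatRep Γ) ∈ AddSubgroup.closure
      (Set.range fun K : Subgroup Γ => GrothendieckAddGroup.of (FinGSet.coset K).perm.cls) := by
  classical
  have := Fintype.ofFinite (MaximalSpectrum (MonoidAlgebra ℚ Γ))
  have key : ∀ (K : Subgroup Γ) (m : MaximalSpectrum (MonoidAlgebra ℚ Γ)),
      (quotChar m.asIdeal).ker = K → (GrothendieckAddGroup.of (FGMod.quot m.asIdeal).cls : RatRep Γ)
      ∈ AddSubgroup.closure
      (Set.range fun K : Subgroup Γ => GrothendieckAddGroup.of (FinGSet.coset K).perm.cls) := by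
    intro K
    induction K using WellFoundedGT.induction with
    | ind K ih =>
      intro m hm
      have h := congrArg GrothendieckAddGroup.of (FinGSet.coset_perm_cls_eq_sum K)
      rw [← Finset.add_sum_erase _ _ (Finset.mem_univ m), if_pos hm.ge, map_add, map_sum,
        ← sub_eq_iff_eq_add] at h
      rw [← h]
      refine sub_mem (AddSubgroup.subset_closure ⟨K, rfl⟩) (sum_mem fun m' hm' => ?_)
      split_ifs with hK
      · refine ih _ (lt_of_le_of_ne hK fun h' => ?_) m' rfl
        exact Finset.ne_of_mem_erase hm' (maximal_eq_of_ker_eq (h'.symm.trans hm.symm))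
      · rw [map_zero]
        exact zero_mem _
  obtain ⟨n, m, hM⟩ := M.exists_cls_eq_sum
  rw [hM, map_sum]
  exact sum_mem fun i _ => key _ _ rfl

end Commutative
/-! ### Characters -/

/-- The diagonal entry at i is 1 or 0 according to whether σ fixes i. It serves both for permutation
modules and for ℚ[H]-free modules. -/
theorem trace_eq_card_fixed {ι M : Type*} [Finite ι] [AddCommGroup M] [Module ℚ M]
    (b : Module.Basis ι ℚ M) (f : M →ₗ[ℚ] M) (σ : ι → ι) (h : ∀ i, f (b i) = b (σ i)) :
    LinearMap.trace ℚ M f = Nat.card {i // σ i = i} := by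
  classical
  have := Fintype.ofFinite ι
  rw [LinearMap.trace_eq_matrix_trace ℚ b, Matrix.trace]
  simp only [Matrix.diag_apply, LinearMap.toMatrix_apply, h, b.repr_self, Finsupp.single_apply]
  rw [Nat.card_eq_fintype_card, Fintype.card_subtype]
  simp

section Character

variable {Γ : Type u} [Group Γ]

noncomputable instance FGMod.ratModule (M : FGMod Γ) : Module ℚ M.carrier :=
  Module.compHom M.carrier (algebraMap ℚ (MonoidAlgebra ℚ Γ))

instance (M : FGMod Γ) : IsScalarTower ℚ (MonoidAlgebra ℚ Γ) M.carrier where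
  smul_assoc a r m := by
    change (a • r) • m = algebraMap ℚ (MonoidAlgebra ℚ Γ) a • r • m
    rw [← mul_smul, Algebra.smul_def]

instance [Finite Γ] : Module.Finite ℚ (MonoidAlgebra ℚ Γ) :=
  Module.Finite.equiv (MonoidAlgebra.coeffLinearEquiv (S := ℚ) (M := Γ) ℚ).symm

instance [Finite Γ] (M : FGMod Γ) : Module.Finite ℚ M.carrier :=
  Module.Finite.trans (MonoidAlgebra ℚ Γ) M.carrier

/-- The trace of `g` on a `ℚ[Γ]`-module. -/
noncomputable def smulTrace (g : Γ) (M : Type*) [AddCommGroup M] [Module (MonoidAlgebra ℚ Γ) M]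
    [Module ℚ M] [IsScalarTower ℚ (MonoidAlgebra ℚ Γ) M] : ℚ :=
  LinearMap.trace ℚ M (Algebra.lsmul ℚ ℚ M (single g 1 : MonoidAlgebra ℚ Γ))

theorem smulTrace_congr (g : Γ) {M N : Type*} [AddCommGroup M] [Module (MonoidAlgebra ℚ Γ) M]
    [Module ℚ M] [IsScalarTower ℚ (MonoidAlgebra ℚ Γ) M] [AddCommGroup N]
    [Module (MonoidAlgebra ℚ Γ) N] [Module ℚ N] [IsScalarTower ℚ (MonoidAlgebra ℚ Γ) N]
    (e : M ≃ₗ[MonoidAlgebra ℚ Γ] N) : smulTrace g M = smulTrace g N := by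
  rw [smulTrace, smulTrace, ← LinearMap.trace_conj' _ (e.restrictScalars ℚ)]
  congr 1
  ext x
  simp [LinearEquiv.conj_apply]

theorem smulTrace_prod (g : Γ) (M N : Type*) [AddCommGroup M] [Module (MonoidAlgebra ℚ Γ) M]
    [Module ℚ M] [IsScalarTower ℚ (MonoidAlgebra ℚ Γ) M] [AddCommGroup N]
    [Module (MonoidAlgebra ℚ Γ) N] [Module ℚ N] [IsScalarTower ℚ (MonoidAlgebra ℚ Γ) N]
    [Module.Finite ℚ M] [Module.Finite ℚ N] :
    smulTrace g (M × N) = smulTrace g M + smulTrace g N := by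
  rw [smulTrace, smulTrace, smulTrace, ← LinearMap.trace_prodMap']
  rfl

/-- The trace of `g` as a homomorphism on isomorphism classes of modules. -/
noncomputable def traceClass [Finite Γ] (g : Γ) : ModClass Γ →+ ℚ where
  toFun := Quotient.lift (fun M => smulTrace g M.carrier) fun _ _ ⟨e⟩ => smulTrace_congr g e
  map_zero' := by
    have : Subsingleton (FGMod.zero Γ).carrier := inferInstanceAs (Subsingleton PUnit)
    change smulTrace g (FGMod.zero Γ).carrier = 0
    rw [smulTrace, Subsingleton.elim (Algebra.lsmul ℚ ℚ _ _) 0, map_zero]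
  map_add' := by
    rintro ⟨M⟩ ⟨N⟩
    refine Eq.trans ?_ (smulTrace_prod g M.carrier N.carrier)
    exact smulTrace_congr g (LinearEquiv.refl (MonoidAlgebra ℚ Γ) (M.carrier × N.carrier))

/-- The standard basis of a permutation module. -/
noncomputable def FinGSet.permBasis (X : FinGSet Γ) : Module.Basis X.carrier ℚ X.perm.carrier :=
  .ofRepr
    { (coeffAddEquiv (R := ℚ) (M := X.carrier) : X.perm.carrier ≃+ (X.carrier →₀ ℚ)) with
      -- The ℚ-structure on the module comes from ℚ[Γ], not from the coefficients; additive maps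
      -- between ℚ-vector spaces are automatically linear, so no comparison is needed.
      map_smul' := fun a x => map_rat_smul
        (coeffAddEquiv (R := ℚ) (M := X.carrier) : X.perm.carrier ≃+ (X.carrier →₀ ℚ)) a x }

theorem FinGSet.permBasis_apply (X : FinGSet Γ) (x : X.carrier) :
    X.permBasis x = X.permSingle x 1 := rfl

theorem traceClass_perm [Finite Γ] (g : Γ) (X : FinGSet Γ) :
    traceClass g X.perm.cls = Nat.card {x : X.carrier // g • x = x} := by
  refine trace_eq_card_fixed X.permBasis _ (g • ·) fun x => ?_
  rw [FinGSet.permBasis_apply, FinGSet.permBasis_apply]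
  refine (X.single_smul_permSingle g x 1 1).trans ?_
  rw [mul_one]

end Character

/-! ### Characters of H-free modules -/

section Relative

variable {G : Type u} {H : Type v} [Group G] [Group H] [Finite G] [Finite H]

/-- A ℚ[H]-basis gives a ℚ-basis indexed by pairs with first entry in H; multiplication by h
translates that entry and so has no fixed index. -/
theorem traceClass_of_isFree {M : FGMod (G × H)} (hM : M.IsFree) {h : H} (hh : h ≠ 1) :
    traceClass ((1, h) : G × H) M.cls = 0 := by
  let : Module (MonoidAlgebra ℚ H) M.carrier := Module.compHom M.carrier (inclAlg G H)
  have : Module.Free (MonoidAlgebra ℚ H) M.carrier := hM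
  have : IsScalarTower ℚ (MonoidAlgebra ℚ H) M.carrier := by
    refine ⟨fun a r m => ?_⟩
    change inclAlg G H (a • r) • m = a • inclAlg G H r • m
    rw [← smul_assoc]
    congr 1
    exact map_rat_smul (inclAlg G H) a r
  let bH : Module.Basis H ℚ (MonoidAlgebra ℚ H) := .ofRepr (MonoidAlgebra.coeffLinearEquiv ℚ)
  let c := Module.Free.chooseBasis (MonoidAlgebra ℚ H) M.carrier
  let b := bH.smulTower c
  have := Module.Finite.finite_basis b
  have hb : ∀ i, b i = (single i.1 1 : MonoidAlgebra ℚ H) • c i.2 :=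
    fun i => Module.Basis.smulTower_apply _ _ _
  refine (trace_eq_card_fixed b _ (fun i => (h * i.1, i.2)) fun i => ?_).trans ?_
  · have h1 : inclAlg G H (single h 1) = single ((1, h) : G × H) 1 := by simp [inclAlg]
    rw [hb, hb, Algebra.lsmul_coe, ← h1]
    change (single h 1 : MonoidAlgebra ℚ H) • (single i.1 1 : MonoidAlgebra ℚ H) • c i.2 = _
    rw [← mul_smul, single_mul_single, mul_one]
  · have : IsEmpty {i : H × Module.Free.ChooseBasisIndex (MonoidAlgebra ℚ H) M.carrier //
        (h * i.1, i.2) = i} := by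
      refine ⟨fun i => hh ?_⟩
      simpa using congrArg Prod.fst i.2
    simp
end Relative
/-! ### Decomposition into orbits -/

section Orbits

variable {Γ : Type u} [Group Γ]

/-- The `Γ`-set underlying an invariant subset. -/
def FinGSet.sub (X : FinGSet Γ) (S : SubMulAction Γ X.carrier) : FinGSet Γ where
  carrier := S

/-- The orbit of a point, as an invariant subset. -/
def FinGSet.orbit (X : FinGSet Γ) (x : X.carrier) : SubMulAction Γ X.carrier where
  carrier := MulAction.orbit Γ x
  smul_mem' g _ hy := MulAction.mem_orbit_of_mem_orbit g hy

theorem FinGSet.cls_eq_sub_add_sub (X : FinGSet Γ) (S : SubMulAction Γ X.carrier) :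
    X.cls = (X.sub S).cls + (X.sub Sᶜ).cls := by
  classical
  refine Quotient.sound (Setoid.symm ⟨Equiv.Set.sumCompl (S : Set X.carrier), ?_⟩)
  rintro g (x | x) <;> rfl

theorem FinGSet.sub_orbit_cls [Finite Γ] (X : FinGSet Γ) (x : X.carrier) :
    (X.sub (X.orbit x)).cls = (FinGSet.coset (MulAction.stabilizer Γ x)).cls := by
  refine Quotient.sound ⟨MulAction.orbitEquivQuotientStabilizer Γ x, fun g y => ?_⟩
  let e := MulAction.orbitEquivQuotientStabilizer Γ x
  obtain ⟨q, rfl⟩ := e.symm.surjective y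
  have h : (g • e.symm q : MulAction.orbit Γ x) = e.symm (g • q) := by
    induction q using QuotientGroup.induction_on with
    | H a => exact Subtype.ext (mul_smul g a x).symm
  exact ((congrArg e h).trans (e.apply_symm_apply _)).trans
    (congrArg (fun z => g • z) (e.apply_symm_apply q).symm)

end Orbits

/-! ### The basis of A(G,H) and the injectivity of f' -/

section Relative

variable (G : Type u) (H : Type v) [CommGroup G] [CommGroup H]

/-- The subgroups of `G × H` that meet `1 × H` trivially. -/
def FreeSubgroup : Type (max u v) :=
  {L : Subgroup (G × H) // ∀ h : H, ((1, h) : G × H) ∈ L → h = 1}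

variable {G H}

theorem smul_coset_eq_iff {Γ : Type*} [CommGroup Γ] (L : Subgroup Γ) (g : Γ) (x : Γ ⧸ L) :
    g • x = x ↔ g ∈ L := by
  induction x using QuotientGroup.induction_on with
  | H a =>
    rw [MulAction.Quotient.smul_coe, smul_eq_mul, QuotientGroup.eq]
    simp

theorem FinGSet.isFree_sub {X : FinGSet (G × H)} (hX : X.IsFree)
    (S : SubMulAction (G × H) X.carrier) : (X.sub S).IsFree :=
  fun h x hx => hX h x.1 (congrArg Subtype.val hx)

variable [Finite G] [Finite H]

theorem FreeSubgroup.isFree (L : FreeSubgroup G H) : (FinGSet.coset L.1).IsFree :=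
  fun h x hx => L.2 h ((smul_coset_eq_iff L.1 (1, h) x).1 hx)

/-- The class of the transitive set `(G × H) / L`. -/
def freeCoset (L : FreeSubgroup G H) : freeGSetClass G H :=
  ⟨(FinGSet.coset L.1).cls, FinGSet.coset L.1, L.isFree, rfl⟩

/-- Split off one orbit and induct on cardinality. Freeness says exactly that point stabilizers meet
1 × H trivially. -/
theorem closure_freeCoset :
    AddSubmonoid.closure (Set.range (freeCoset : FreeSubgroup G H → freeGSetClass G H)) = ⊤ := by
  refine top_unique ?_
  rintro ⟨_, X, hX, rfl⟩ -
  induction hn : Nat.card X.carrier using Nat.strong_induction_on generalizing X with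
  | _ n ih =>
    rcases isEmpty_or_nonempty X.carrier with hempty | ⟨⟨x⟩⟩
    · have : IsEmpty (FinGSet.empty (G × H)).carrier := inferInstanceAs (IsEmpty PEmpty)
      have h0 : X.cls = 0 :=
        Quotient.sound ⟨Equiv.equivOfIsEmpty _ _, fun _ x => isEmptyElim x⟩
      have h1 : (⟨X.cls, X, hX, rfl⟩ : freeGSetClass G H) = 0 := Subtype.ext h0
      exact h1 ▸ zero_mem (AddSubmonoid.closure (Set.range freeCoset))
    · have hfree := FinGSet.isFree_sub hX (X.orbit x)ᶜ
      have hlt : Nat.card (X.sub (X.orbit x)ᶜ).carrier < n := by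
        rw [← hn]
        exact Finite.card_subtype_lt (x := x) fun h => h (MulAction.mem_orbit_self x)
      let L : FreeSubgroup G H := ⟨MulAction.stabilizer (G × H) x, fun h hh => hX h x hh⟩
      have h1 : (⟨X.cls, X, hX, rfl⟩ : freeGSetClass G H) =
          freeCoset L + ⟨(X.sub (X.orbit x)ᶜ).cls, _, hfree, rfl⟩ := by
        refine Subtype.ext ((X.cls_eq_sub_add_sub (X.orbit x)).trans ?_)
        rw [FinGSet.sub_orbit_cls]
        rfl
      have h2 := add_mem (AddSubmonoid.subset_closure (Set.mem_range_self L)) (ih _ hlt _ hfree rfl)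
      exact h1 ▸ h2

/-- The homomorphism from the free abelian group on the subgroups meeting `1 × H` trivially. -/
noncomputable def cosetMap : (FreeSubgroup G H →₀ ℤ) →ₗ[ℤ] RelA G H :=
  Finsupp.linearCombination ℤ fun L => GrothendieckAddGroup.of (freeCoset L)

theorem cosetMap_surjective : Function.Surjective (cosetMap : _ →ₗ[ℤ] RelA G H) := by
  have h : ∀ c : freeGSetClass G H, GrothendieckAddGroup.of c ∈
      LinearMap.range (cosetMap (G := G) (H := H)) := by
    intro c
    have hc : c ∈ AddSubmonoid.closure
        (Set.range (freeCoset : FreeSubgroup G H → freeGSetClass G H)) :=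
      (closure_freeCoset (G := G) (H := H)).symm ▸ AddSubmonoid.mem_top c
    induction hc using AddSubmonoid.closure_induction with
    | mem x hx =>
      obtain ⟨L, rfl⟩ := hx
      exact ⟨Finsupp.single L 1, by simp [cosetMap]⟩
    | zero => rw [map_zero]; exact zero_mem _
    | add x y _ _ hx hy => rw [map_add]; exact add_mem hx hy
  intro x
  obtain ⟨a, b, rfl⟩ := exists_of_sub_of x
  exact sub_mem (h a) (h b)

variable (G H) in
/-- The homomorphism `R(G,H) → R(G × H)`. -/
noncomputable def relRatIncl : RelR G H →+ RatRep (G × H) :=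
  grothendieckMap (freeModClass G H).subtype

/-- The value at `g` of the character of a virtual representation. -/
noncomputable def ratTrace {Γ : Type u} [Group Γ] [Finite Γ] (g : Γ) : RatRep Γ →+ ℚ :=
  GrothendieckAddGroup.lift (traceClass g)

theorem ratTrace_of {Γ : Type u} [Group Γ] [Finite Γ] (g : Γ) (c : ModClass Γ) :
    ratTrace g (GrothendieckAddGroup.of c) = traceClass g c := lift_of _ _

theorem relRatIncl_relPermMap_freeCoset (L : FreeSubgroup G H) :
    relRatIncl G H (relPermMap G H (GrothendieckAddGroup.of (freeCoset L))) =
      GrothendieckAddGroup.of (FinGSet.coset L.1).perm.cls := by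
  rw [relPermMap, relRatIncl, grothendieckMap_of, grothendieckMap_of]
  rfl

-- In an abelian group every coset of L has stabilizer L, so g fixes all cosets or none.
open Classical in
theorem traceClass_coset {Γ : Type u} [CommGroup Γ] [Finite Γ] (g : Γ) (L : Subgroup Γ) :
    traceClass g (FinGSet.coset L).perm.cls = if g ∈ L then (L.index : ℚ) else 0 := by
  rw [traceClass_perm]
  have h : ∀ x : (FinGSet.coset L).carrier, g • x = x ↔ g ∈ L := smul_coset_eq_iff L g
  simp only [h]
  split_ifs with hg
  · simp only [hg]
    rw [Nat.card_congr (Equiv.subtypeUnivEquiv fun _ => trivial)]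
    rfl
  · simp [hg]

omit [Finite G] [Finite H] in
theorem FreeSubgroup.isCyclic [IsCyclic G] (L : FreeSubgroup G H) : IsCyclic L.1 := by
  refine isCyclic_of_injective ((MonoidHom.fst G H).comp L.1.subtype) ?_
  rw [injective_iff_map_eq_one]
  rintro ⟨⟨g, h⟩, hL⟩ (rfl : g = 1)
  obtain rfl := L.2 h hL
  rfl

/-- Take L maximal in the support of c and g a generator of L. Only subgroups containing g, that is
containing L, contribute at g; by maximality that leaves L alone, with the nonzero factor [Γ : L].
-/
theorem eq_zero_of_ratTrace_cosetMap [IsCyclic G] (c : FreeSubgroup G H →₀ ℤ)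
    (hc : ∀ g, ratTrace g (relRatIncl G H (relPermMap G H (cosetMap c))) = 0) : c = 0 := by
  classical
  by_contra h0
  obtain ⟨L₀, hL₀, hmax⟩ := (c.support.image fun L : FreeSubgroup G H => L.1).exists_maximal
    ((Finsupp.support_nonempty_iff.2 h0).image _)
  obtain ⟨L, hL, rfl⟩ : ∃ L : FreeSubgroup G H, L ∈ c.support ∧ L.1 = L₀ :=
    Finset.mem_image.1 hL₀
  have := FreeSubgroup.isCyclic L
  obtain ⟨⟨g, hgL⟩, hg⟩ := IsCyclic.exists_generator (α := L.1)
  have h := hc g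
  have hle : ∀ L' : FreeSubgroup G H, g ∈ L'.1 → L.1 ≤ L'.1 := by
    intro L' hL' x hx
    obtain ⟨n, hn⟩ := Subgroup.mem_zpowers_iff.1 (hg ⟨x, hx⟩)
    have : g ^ n = x := congrArg Subtype.val hn
    exact this ▸ L'.1.zpow_mem hL' n
  rw [cosetMap, Finsupp.linearCombination_apply, Finsupp.sum, map_sum, map_sum, map_sum,
    Finset.sum_eq_single L] at h
  · rw [map_zsmul, map_zsmul, map_zsmul, relRatIncl_relPermMap_freeCoset, ratTrace_of,
      traceClass_coset, if_pos hgL, zsmul_eq_mul, mul_eq_zero] at h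
    rcases h with h | h
    · exact Finsupp.mem_support_iff.1 hL (by exact_mod_cast h)
    · exact Subgroup.index_ne_zero_of_finite (H := L.1) (by exact_mod_cast h)
  · intro L' hL' hne
    rw [map_zsmul, map_zsmul, map_zsmul, relRatIncl_relPermMap_freeCoset, ratTrace_of,
      traceClass_coset, if_neg, smul_zero]
    intro hg'
    have h1 := hle L' hg'
    exact hne (Subtype.ext (le_antisymm (hmax (Finset.mem_image_of_mem _ hL') h1) h1))
  · exact fun h => absurd hL h

theorem cosetMap_bijective [IsCyclic G] : Function.Bijective (cosetMap : _ →ₗ[ℤ] RelA G H) := by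
  refine ⟨(injective_iff_map_eq_zero _).2 fun c hc => ?_, cosetMap_surjective⟩
  exact eq_zero_of_ratTrace_cosetMap c fun g => by simp [hc]

theorem relPermMap_injective [IsCyclic G] : Function.Injective (relPermMap G H) := by
  refine (injective_iff_map_eq_zero _).2 fun a ha => ?_
  obtain ⟨c, rfl⟩ := cosetMap_surjective a
  rw [eq_zero_of_ratTrace_cosetMap c fun g => by rw [ha, map_zero, map_zero], map_zero]

end Relative
/-! ### Cyclic groups of prime power order -/

theorem exists_zpowers_eq_zpowers_prime_pow {p k : ℕ} (hp : p.Prime) {G : Type*} [Group G]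
    (hG : Nat.card G = p ^ k) {g : G} (hg : ∀ x, x ∈ Subgroup.zpowers g) (P : Subgroup G) :
    ∃ j ≤ k, P = Subgroup.zpowers (g ^ p ^ j) := by
  have : Finite G := Nat.finite_of_card_ne_zero (hG ▸ (pow_pos hp.pos k).ne')
  have : IsCyclic G := ⟨g, hg⟩
  have htop : ∀ i, k ≤ i → g ^ p ^ i = 1 := fun i hi =>
    orderOf_dvd_iff_pow_eq_one.1 ((orderOf_dvd_natCard g).trans (hG ▸ pow_dvd_pow p hi))
  obtain ⟨⟨x, hxP⟩, hx⟩ := IsCyclic.exists_generator (α := P)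
  have hP : P = Subgroup.zpowers x := by
    refine le_antisymm (fun y hy => ?_) (Subgroup.zpowers_le.2 hxP)
    obtain ⟨n, hn⟩ := Subgroup.mem_zpowers_iff.1 (hx ⟨y, hy⟩)
    exact ⟨n, congrArg Subtype.val hn⟩
  -- The bound on j is free: all exponents j ≥ k give the trivial subgroup.
  suffices h : ∃ j, P = Subgroup.zpowers (g ^ p ^ j) by
    obtain ⟨j, hj⟩ := h
    rcases le_total j k with hjk | hjk
    · exact ⟨j, hjk, hj⟩
    · exact ⟨k, le_rfl, by rw [hj, htop j hjk, htop k le_rfl]⟩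
  obtain ⟨n, rfl⟩ := mem_powers_iff_mem_zpowers.2 (hg x)
  rcases Nat.eq_zero_or_pos n with rfl | hn
  · exact ⟨k, by rw [hP, htop k le_rfl]; simp⟩
  -- The factor u is prime to p, hence to the order of g^(p^i), so it does not change the generated
  -- subgroup.
  obtain ⟨i, u, hu, rfl⟩ := Nat.exists_eq_pow_mul_and_not_dvd hn.ne' p hp.ne_one
  refine ⟨i, hP.trans ?_⟩
  have hcop : u.Coprime (orderOf (g ^ p ^ i)) := by
    refine Nat.Coprime.coprime_dvd_right (hG ▸ orderOf_dvd_natCard _) ?_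
    exact Nat.Coprime.pow_right _ ((hp.coprime_iff_not_dvd.2 hu).symm)
  obtain ⟨m, hm⟩ := exists_pow_eq_self_of_coprime hcop
  refine le_antisymm (Subgroup.zpowers_le.2 ?_) (Subgroup.zpowers_le.2 ?_)
  · exact ⟨u, by simp [pow_mul]⟩
  · exact ⟨m, by simpa [pow_mul] using hm⟩

/-! ### The relation coming from elementary abelian subquotients of rank two -/

-- Write q = |H|. If y is trivial, the last sum is q copies of the condition x = 1. Otherwise y is
-- injective, since q is prime, so its values are all the q-th roots of unity; then x y(h) = 1 has
-- exactly one solution if x^q = 1 and none otherwise. The form without subtraction is needed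
-- because a will be an isomorphism class in a mere monoid.
open Classical in
theorem sum_ite_mul_eq_one {H F A : Type*} [CommGroup H] [Fintype H] [Field F] [AddCommMonoid A]
    (hH : (Nat.card H).Prime) (x : F) (y : H →* F) (a : A) :
    (if x ^ Nat.card H = 1 then a else 0) +
        Nat.card H • (if x = 1 ∧ ∀ h, y h = 1 then a else 0) =
      (if x ^ Nat.card H = 1 ∧ ∀ h, y h = 1 then a else 0) +
        ∑ h, if x * y h = 1 then a else 0 := by
  by_cases hy : ∀ h, y h = 1
  · simp [hy]
  have hF : Fact (Nat.card H).Prime := ⟨hH⟩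
  obtain ⟨h₁, hh₁⟩ := not_forall.1 hy
  have hker : y.ker = ⊥ := by
    refine (Subgroup.eq_bot_or_eq_top_of_prime_card y.ker).resolve_right fun h => hy fun z => ?_
    exact MonoidHom.mem_ker.1 (h ▸ Subgroup.mem_top z)
  have hinj : Function.Injective y := (MonoidHom.ker_eq_bot_iff y).1 hker
  have hpow : ∀ h, y h ^ Nat.card H = 1 := fun h => by rw [← map_pow, pow_card_eq_one', map_one]
  rw [if_neg (c := x = 1 ∧ _) fun h => hy h.2, if_neg (c := _ ∧ _) fun h => hy h.2, smul_zero,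
    add_zero, zero_add]
  split_ifs with hx
  · have hx0 : x ≠ 0 := fun h => by simp [h] at hx
    have hprim : IsPrimitiveRoot (y h₁) (Nat.card H) := by
      have := orderOf_eq_prime (hpow h₁) hh₁
      exact this ▸ IsPrimitiveRoot.orderOf (y h₁)
    have : NeZero (Nat.card H) := ⟨hH.ne_zero⟩
    obtain ⟨i, -, hi⟩ := hprim.eq_pow_of_pow_eq_one (ξ := x⁻¹) (by rw [inv_pow, hx, inv_one])
    rw [← map_pow] at hi
    have hiff : ∀ h, x * y h = 1 ↔ h = h₁ ^ i := by
      intro h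
      rw [← hinj.eq_iff, hi, mul_eq_one_iff_inv_eq₀ hx0, eq_comm]
    simp [hiff]
  · refine (Finset.sum_eq_zero fun h _ => if_neg fun hxy => hx ?_).symm
    rw [← mul_one (x ^ Nat.card H), ← hpow h, ← mul_pow, hxy, one_pow, hpow]

section Relative

variable {G : Type u} {H : Type v} [CommGroup G] [CommGroup H] [Finite G] [Finite H]

-- All four conditions depend only on x = χ(g,1) and the restriction y of χ to H. This computes the
-- multiplicity of one simple module on each side of `perm_relation`.
open Classical in
omit [Finite G] [Finite H] in
theorem sum_ite_le_ker {F A : Type*} [Fintype H] [Field F] [AddCommMonoid A]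
    (hH : (Nat.card H).Prime) (g : G) (χ : G × H →* F) (a : A) :
    (if Subgroup.zpowers ((g ^ Nat.card H, 1) : G × H) ≤ χ.ker then a else 0) +
        Nat.card H • (if (Subgroup.zpowers g).prod (⊤ : Subgroup H) ≤ χ.ker then a else 0) =
      (if (Subgroup.zpowers (g ^ Nat.card H)).prod (⊤ : Subgroup H) ≤ χ.ker then a else 0) +
        ∑ h : H, if Subgroup.zpowers ((g, h) : G × H) ≤ χ.ker then a else 0 := by
  have h1 : ∀ n : ℕ, χ (g ^ n, 1) = χ (g, 1) ^ n := fun n => by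
    rw [← map_pow, Prod.pow_mk, one_pow]
  have h2 : ∀ h, χ (g, h) = χ (g, 1) * χ.comp (MonoidHom.inr G H) h := fun h => by
    change _ = χ (g, 1) * χ (1, h)
    rw [← map_mul, Prod.mk_mul_mk, mul_one, one_mul]
  have h3 : ∀ z : G, (Subgroup.zpowers z).prod (⊤ : Subgroup H) ≤ χ.ker ↔
      χ (z, 1) = 1 ∧ ∀ h, χ.comp (MonoidHom.inr G H) h = 1 := by
    intro z
    constructor
    · intro h
      exact ⟨h (Subgroup.mem_prod.2 ⟨Subgroup.mem_zpowers z, trivial⟩),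
        fun w => h (Subgroup.mem_prod.2 ⟨one_mem _, trivial⟩)⟩
    · rintro ⟨ha, hb⟩ ⟨_, w⟩ ⟨⟨n, rfl⟩, -⟩
      have hzw : ((z ^ n, w) : G × H) = (z, 1) ^ n * (1, w) := by simp
      exact hzw ▸ mul_mem (zpow_mem (K := χ.ker) ha n) (hb w)
  simp only [Subgroup.zpowers_le, MonoidHom.mem_ker, h3, h1]
  generalize χ (g, 1) = x at h2 ⊢
  simp only [h2]
  exact sum_ite_mul_eq_one hH _ _ a

/-- For p = |H| dividing the order of g, this is the classical relation for E = (⟨g⟩ × H)/(⟨g^p⟩ ×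
1) ≅ ℤ_p × ℤ_p, namely ℚ[E] + p ℚ = ∑ ℚ[E/U] over the p + 1 subgroups U of order p: the image of H
and the images of the ⟨(g,h)⟩. -/
theorem perm_relation [Fintype H] (hH : (Nat.card H).Prime) (g : G) :
    (FinGSet.coset (Subgroup.zpowers ((g ^ Nat.card H, 1) : G × H))).perm.cls +
        Nat.card H • (FinGSet.coset ((Subgroup.zpowers g).prod (⊤ : Subgroup H))).perm.cls =
      (FinGSet.coset ((Subgroup.zpowers (g ^ Nat.card H)).prod (⊤ : Subgroup H))).perm.cls +
        ∑ h : H, (FinGSet.coset (Subgroup.zpowers ((g, h) : G × H))).perm.cls := by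
  classical
  have := Fintype.ofFinite (MaximalSpectrum (MonoidAlgebra ℚ (G × H)))
  simp only [FinGSet.coset_perm_cls_eq_sum]
  rw [Finset.sum_comm, Finset.smul_sum, ← Finset.sum_add_distrib, ← Finset.sum_add_distrib]
  refine Finset.sum_congr rfl fun m _ => ?_
  have := m.isMaximal
  let := Ideal.Quotient.field m.asIdeal
  exact sum_ite_le_ker hH g (quotChar m.asIdeal) _

/-! ### Surjectivity -/

-- If (g,h)^n has trivial first entry, then p divides n, because g is a nontrivial p-element; hence
-- h^n = 1.
omit [Finite G] [Finite H] in
theorem zpowers_inter_eq_one {p k : ℕ} (hp : p.Prime) (hG : Nat.card G = p ^ k)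
    (hH : Nat.card H = p) {g : G} (hg : g ≠ 1) (h h' : H)
    (hmem : ((1, h') : G × H) ∈ Subgroup.zpowers ((g, h) : G × H)) : h' = 1 := by
  have : Finite G := Nat.finite_of_card_ne_zero (hG ▸ (pow_pos hp.pos k).ne')
  obtain ⟨n, hn⟩ := hmem
  have h1 : g ^ n = 1 := congrArg Prod.fst hn
  have h2 : h ^ n = h' := congrArg Prod.snd hn
  have hpg : p ∣ orderOf g := by
    obtain ⟨i, -, hi⟩ := (Nat.dvd_prime_pow hp).1 (hG ▸ orderOf_dvd_natCard g)
    rcases i with _ | i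
    · exact absurd (orderOf_eq_one_iff.1 hi) hg
    · exact hi ▸ dvd_pow_self p i.succ_ne_zero
  obtain ⟨m, rfl⟩ := (Int.natCast_dvd_natCast.2 hpg).trans (orderOf_dvd_iff_zpow_eq_one.2 h1)
  rw [← h2, zpow_mul, zpow_natCast, ← hH, pow_card_eq_one', one_zpow]

variable (G H) in
/-- The subgroup of `R(G × H)` generated by `f' (A(G,H))` and the trivial module. -/
noncomputable def permSpan : AddSubgroup (RatRep (G × H)) :=
  ((relRatIncl G H).comp (relPermMap G H)).range ⊔
    AddSubgroup.zmultiples (GrothendieckAddGroup.of (FinGSet.coset (⊤ : Subgroup (G × H))).perm.cls)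

theorem coset_mem_permSpan_of_free {L : Subgroup (G × H)}
    (hL : ∀ h : H, ((1, h) : G × H) ∈ L → h = 1) :
    GrothendieckAddGroup.of (FinGSet.coset L).perm.cls ∈ permSpan G H :=
  AddSubgroup.mem_sup_left ⟨_, relRatIncl_relPermMap_freeCoset ⟨L, hL⟩⟩

/-- The relation for g^(p^j) expresses the case j + 1 through p times the case j and classes of
subgroups meeting 1 × H trivially. -/
theorem prod_mem_permSpan {p k : ℕ} (hp : p.Prime) (hG : Nat.card G = p ^ k)
    (hH : Nat.card H = p) {g : G} (hg : ∀ x, x ∈ Subgroup.zpowers g) (j : ℕ) :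
    GrothendieckAddGroup.of (FinGSet.coset
      ((Subgroup.zpowers (g ^ p ^ j)).prod (⊤ : Subgroup H))).perm.cls ∈ permSpan G H := by
  induction j with
  | zero =>
    have : (Subgroup.zpowers (g ^ p ^ 0)).prod (⊤ : Subgroup H) = ⊤ := by
      rw [pow_zero, pow_one, (Subgroup.eq_top_iff' _).2 hg, Subgroup.top_prod_top]
    rw [this]
    exact AddSubgroup.mem_sup_right (AddSubgroup.mem_zmultiples _)
  | succ j ih =>
    have := Fintype.ofFinite H
    have hpow : g ^ p ^ (j + 1) = (g ^ p ^ j) ^ Nat.card H := by rw [hH, pow_succ, pow_mul]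
    rw [hpow]
    -- Here ⟨(1,h)⟩ would not be free, so the relation is unusable; but the subgroup no longer
    -- changes with j.
    by_cases h1 : g ^ p ^ j = 1
    · rw [h1] at ih ⊢
      rwa [one_pow]
    have h := congrArg GrothendieckAddGroup.of (perm_relation (hH ▸ hp) (H := H) (g ^ p ^ j))
    rw [map_add, map_add, map_nsmul, map_sum, ← sub_eq_iff_eq_add] at h
    rw [← h]
    refine sub_mem (add_mem (coset_mem_permSpan_of_free ?_) (nsmul_mem ih _))
      (sum_mem fun z _ => coset_mem_permSpan_of_free (zpowers_inter_eq_one hp hG hH h1 z))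
    rintro w ⟨n, hn⟩
    simpa using (congrArg Prod.snd hn).symm

theorem coset_mem_permSpan {p k : ℕ} (hp : p.Prime) (hG : Nat.card G = p ^ k)
    (hH : Nat.card H = p) [IsCyclic G] (K : Subgroup (G × H)) :
    GrothendieckAddGroup.of (FinGSet.coset K).perm.cls ∈ permSpan G H := by
  obtain ⟨g, hg⟩ := IsCyclic.exists_generator (α := G)
  have : Fact (Nat.card H).Prime := ⟨hH ▸ hp⟩
  rcases Subgroup.eq_bot_or_eq_top_of_prime_card (K.comap (MonoidHom.inr G H)) with h | h
  · refine coset_mem_permSpan_of_free fun w hw => ?_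
    have : w ∈ K.comap (MonoidHom.inr G H) := hw
    rwa [h, Subgroup.mem_bot] at this
  · obtain ⟨j, -, hj⟩ := exists_zpowers_eq_zpowers_prime_pow hp hG hg
      (K.comap (MonoidHom.inl G H))
    have hw : ∀ w : H, ((1, w) : G × H) ∈ K := fun w =>
      Subgroup.mem_comap.1 (h ▸ Subgroup.mem_top w)
    -- K contains 1 × H, so it is the product of its intersection with G and H.
    have hK : K = (Subgroup.zpowers (g ^ p ^ j)).prod (⊤ : Subgroup H) := by
      rw [← hj]
      ext ⟨x, w⟩
      rw [Subgroup.mem_prod, Subgroup.mem_comap]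
      have hxw : ((x, w) : G × H) = (x, 1) * (1, w) := by simp
      rw [hxw, K.mul_mem_cancel_right (hw w)]
      simp
    rw [hK]
    exact prod_mem_permSpan hp hG hH hg j

/-- The condition is stable under sums, and each simple module is a summand of the regular module
ℚ[Γ/1], which is H-free. -/
theorem exists_add_mem_freeModClass (c : ModClass (G × H)) : ∃ d, c + d ∈ freeModClass G H := by
  classical
  have := Fintype.ofFinite (MaximalSpectrum (MonoidAlgebra ℚ (G × H)))
  let S : AddSubmonoid (ModClass (G × H)) :=
    { carrier := {c | ∃ d, c + d ∈ freeModClass G H}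
      zero_mem' := ⟨0, by simp⟩
      add_mem' := by
        rintro a b ⟨a', ha⟩ ⟨b', hb⟩
        exact ⟨a' + b', by simpa only [add_add_add_comm] using add_mem ha hb⟩ }
  obtain ⟨M, rfl⟩ := Quotient.exists_rep c
  obtain ⟨n, m, hM⟩ := M.exists_cls_eq_sum
  suffices M.cls ∈ S from this
  rw [hM]
  refine sum_mem fun i _ => ?_
  have hbot := FinGSet.coset_perm_cls_eq_sum (⊥ : Subgroup (G × H))
  simp only [bot_le, if_true] at hbot
  rw [← Finset.add_sum_erase _ _ (Finset.mem_univ (m i))] at hbot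
  have hfree : (FinGSet.coset (⊥ : Subgroup (G × H))).perm.cls ∈ freeModClass G H :=
    ⟨_, FinGSet.IsFree.perm (FreeSubgroup.isFree ⟨⊥, fun h hh => by simpa using hh⟩), rfl⟩
  exact ⟨_, hbot ▸ hfree⟩

/-- Equality in R(G × H) means equality after adding some class c; completing c to an H-free class
gives the same equality inside R(G,H). -/
theorem relRatIncl_injective : Function.Injective (relRatIncl G H) := by
  refine (injective_iff_map_eq_zero _).2 fun x hx => ?_
  obtain ⟨a, b, rfl⟩ := exists_of_sub_of x
  rw [map_sub, sub_eq_zero, relRatIncl, grothendieckMap_of, grothendieckMap_of, of_eq_of_iff] at hx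
  obtain ⟨c, hc⟩ := hx
  obtain ⟨d, hd⟩ := exists_add_mem_freeModClass c
  rw [sub_eq_zero, of_eq_of_iff]
  refine ⟨⟨c + d, hd⟩, Subtype.ext ?_⟩
  change c + d + (freeModClass G H).subtype a = c + d + (freeModClass G H).subtype b
  rw [add_right_comm, hc, add_right_comm]

theorem ratTrace_relRatIncl {h : H} (hh : h ≠ 1) (x : RelR G H) :
    ratTrace ((1, h) : G × H) (relRatIncl G H x) = 0 := by
  have key : ∀ c : freeModClass G H,
      ratTrace ((1, h) : G × H) (relRatIncl G H (GrothendieckAddGroup.of c)) = 0 := by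
    rintro ⟨_, M, hM, rfl⟩
    rw [relRatIncl, grothendieckMap_of, ratTrace_of]
    exact traceClass_of_isFree hM hh
  obtain ⟨a, b, rfl⟩ := exists_of_sub_of x
  rw [map_sub, map_sub, key, key, sub_zero]

/-- An H-free class is f'(a) plus n times the trivial module; the trace of (1,h) with h ≠ 1 reads
off n = 0. -/
theorem relPermMap_surjective {p k : ℕ} (hp : p.Prime) (hG : Nat.card G = p ^ k)
    (hH : Nat.card H = p) [IsCyclic G] : Function.Surjective (relPermMap G H) := by
  have hnt : Nontrivial H := (Finite.one_lt_card_iff_nontrivial).1 (hH ▸ hp.one_lt)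
  obtain ⟨h, hh⟩ := exists_ne (1 : H)
  have key : ∀ c : freeModClass G H, GrothendieckAddGroup.of c ∈ (relPermMap G H).range := by
    intro c
    obtain ⟨M, hM⟩ := Quotient.exists_rep c.1
    have hmem : relRatIncl G H (GrothendieckAddGroup.of c) ∈ permSpan G H := by
      rw [relRatIncl, grothendieckMap_of]
      change GrothendieckAddGroup.of c.1 ∈ _
      rw [← hM]
      refine (AddSubgroup.closure_le _).2 ?_ (of_cls_mem_closure_coset M)
      rintro _ ⟨K, rfl⟩
      exact coset_mem_permSpan hp hG hH K
    obtain ⟨_, ⟨a, rfl⟩, _, ⟨n, rfl⟩, han⟩ := AddSubgroup.mem_sup.1 hmem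
    have htr := congrArg (ratTrace ((1, h) : G × H)) han
    simp only [AddMonoidHom.comp_apply] at htr han
    rw [map_add, ratTrace_relRatIncl hh, ratTrace_relRatIncl hh, map_zsmul, ratTrace_of,
      traceClass_coset, if_pos (Subgroup.mem_top _), Subgroup.index_top] at htr
    have hn : n = 0 := by simpa using htr
    rw [hn, zero_smul, add_zero] at han
    exact ⟨a, relRatIncl_injective han⟩
  intro x
  obtain ⟨a, b, rfl⟩ := exists_of_sub_of x
  exact sub_mem (key a) (key b)

end Relative
/-! ### The rank -/

section Count

variable {G : Type u} {H : Type v} [CommGroup G] [CommGroup H]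

/-- The projection of such a subgroup to G is ⟨g^(p^i)⟩ with i ≤ k. For i = k the subgroup is
trivial; for i < k it is generated by (g^(p^i), h) for a unique h, which leaves p choices. -/
theorem card_freeSubgroup [IsCyclic G] {p k : ℕ} (hp : p.Prime) (hG : Nat.card G = p ^ k)
    (hH : Nat.card H = p) : Nat.card (FreeSubgroup G H) = k * p + 1 := by
  have : Finite H := Nat.finite_of_card_ne_zero (hH ▸ hp.ne_zero)
  obtain ⟨g, hg⟩ := IsCyclic.exists_generator (α := G)
  have hord : orderOf g = p ^ k := (orderOf_eq_card_of_forall_mem_zpowers hg).trans hG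
  have hordpow : ∀ i ≤ k, orderOf (g ^ p ^ i) = p ^ (k - i) := fun i hi => by
    rw [orderOf_pow_of_dvd (pow_pos hp.pos i).ne' (hord ▸ pow_dvd_pow p hi), hord,
      Nat.pow_div hi hp.pos]
  have hne : ∀ i : Fin k, g ^ p ^ (i : ℕ) ≠ 1 := fun i h => by
    have := hordpow i i.2.le
    rw [h, orderOf_one] at this
    exact (Nat.one_lt_pow (Nat.sub_ne_zero_of_lt i.2) hp.one_lt).ne this
  let f : Option (Fin k × H) → FreeSubgroup G H
    | none => ⟨⊥, fun h hh => by simpa using hh⟩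
    | some (i, h) => ⟨Subgroup.zpowers (g ^ p ^ (i : ℕ), h),
        zpowers_inter_eq_one hp hG hH (hne i) h⟩
  have hbot : ∀ i h, Subgroup.zpowers ((g ^ p ^ (i : Fin k).1, h) : G × H) ≠ ⊥ := fun i h hbot =>
    hne i (congrArg Prod.fst (Subgroup.zpowers_eq_bot.1 hbot))
  have hf : Function.Bijective f := by
    constructor
    · rintro (_ | ⟨i, h⟩) (_ | ⟨i', h'⟩) heq
      · rfl
      · exact absurd (congrArg Subtype.val heq).symm (hbot i' h')
      · exact absurd (congrArg Subtype.val heq) (hbot i h)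
      · have heq : Subgroup.zpowers ((g ^ p ^ (i : ℕ), h) : G × H) =
            Subgroup.zpowers (g ^ p ^ (i' : ℕ), h') := congrArg Subtype.val heq
        have hi : i = i' := by
          have h1 := congrArg (Subgroup.map (MonoidHom.fst G H)) heq
          rw [MonoidHom.map_zpowers, MonoidHom.map_zpowers] at h1
          have h2 := congrArg (fun K : Subgroup G => Nat.card K) h1
          simp only [Nat.card_zpowers, MonoidHom.coe_fst] at h2
          rw [hordpow i i.2.le, hordpow i' i'.2.le] at h2
          have h3 := Nat.pow_right_injective hp.two_le h2
          exact Fin.ext (by omega)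
        subst hi
        have h1 : ((g ^ p ^ (i : ℕ), h) : G × H) ∈ Subgroup.zpowers (g ^ p ^ (i : ℕ), h') :=
          heq ▸ Subgroup.mem_zpowers _
        have h2 := Subgroup.mul_mem _ h1 (Subgroup.inv_mem _ (Subgroup.mem_zpowers _))
        have h3 : h * h'⁻¹ = 1 := zpowers_inter_eq_one hp hG hH (hne i) h' _ (by simpa using h2)
        rw [mul_inv_eq_one.1 h3]
    · rintro ⟨L, hL⟩
      obtain ⟨j, hjk, hj⟩ := exists_zpowers_eq_zpowers_prime_pow hp hG hg
        (L.map (MonoidHom.fst G H))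
      rcases hjk.eq_or_lt with rfl | hjk
      · refine ⟨none, Subtype.ext (le_antisymm bot_le ?_)⟩
        rintro ⟨x, w⟩ hxw
        have h1 : x ∈ L.map (MonoidHom.fst G H) := ⟨_, hxw, rfl⟩
        have h2 : g ^ p ^ j = 1 := hord ▸ pow_orderOf_eq_one g
        rw [hj, h2, Subgroup.zpowers_one_eq_bot, Subgroup.mem_bot] at h1
        subst h1
        rw [hL w hxw]
        exact one_mem _
      · obtain ⟨⟨x, h⟩, hxh, (rfl : x = _)⟩ : g ^ p ^ j ∈ L.map (MonoidHom.fst G H) :=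
          hj ▸ Subgroup.mem_zpowers _
        refine ⟨some (⟨j, hjk⟩, h), Subtype.ext (le_antisymm (Subgroup.zpowers_le.2 hxh) ?_)⟩
        rintro ⟨y, w⟩ hyw
        obtain ⟨n, rfl⟩ : y ∈ Subgroup.zpowers (g ^ p ^ j) := hj ▸ ⟨_, hyw, rfl⟩
        -- Dividing (y,w) by the n-th power of the generator lands in L ∩ (1 × H) = 1.
        have h1 := hL (w * (h ^ n)⁻¹)
          (by simpa using L.mul_mem hyw (L.inv_mem (L.zpow_mem hxh n)))
        exact ⟨n, Prod.ext rfl (mul_inv_eq_one.1 h1).symm⟩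
  rw [← Nat.card_eq_of_bijective f hf, Finite.card_option, Nat.card_prod, hH]
  simp

end Count

/-! ### Subquotients -/

/-- Commutativity rules out the nonabelian types. If T ≅ ℤ_p × ℤ_p, then L/C has order p^3 and is
killed by p, so it is a quotient of L/L^p, whose order is |L[p]| ≤ |G[p]| · |H| ≤ p^2. -/
theorem not_isBasicSubquotient {p k : ℕ} (hp : p.Prime) {G : Type u} {H : Type v} [CommGroup G]
    [CommGroup H] [IsCyclic G] (hG : Nat.card G = p ^ k) (hH : Nat.card H = p)
    (L : Subgroup (G × H)) (C : Subgroup L) [C.Normal] : ¬ IsBasicSubquotient H p (L ⧸ C) := by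
  rintro ⟨T, _, hT, ⟨e⟩⟩
  have : Finite G := Nat.finite_of_card_ne_zero (hG ▸ (pow_pos hp.pos k).ne')
  have : Finite H := Nat.finite_of_card_ne_zero (hH ▸ hp.ne_zero)
  have hcomm : ∀ a b : T, a * b = b * a := by
    intro a b
    have h := mul_comm (e.symm (a, 1)) (e.symm (b, 1))
    rw [← map_mul, ← map_mul] at h
    exact congrArg Prod.fst (e.symm.injective h)
  rcases hT with ⟨⟨t⟩⟩ | ⟨-, m, hm, ⟨t⟩⟩ | ⟨-, -, a, b, hab⟩
  · have hNe : NeZero p := ⟨hp.ne_zero⟩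
    have hcard : Nat.card (L ⧸ C) = p * p * p := by
      rw [Nat.card_congr e.toEquiv, Nat.card_prod, Nat.card_congr t.toEquiv, Nat.card_prod, hH]
      simp
    have hexp : ∀ x : L ⧸ C, x ^ p = 1 := by
      intro x
      refine e.injective ?_
      rw [map_pow, map_one]
      refine Prod.ext (t.injective ?_) (by simp [← hH])
      have hz : ∀ z : Multiplicative (ZMod p), z ^ p = 1 := fun z => by
        simpa using pow_card_eq_one' (x := z)
      rw [Prod.pow_fst, map_pow]
      exact (Prod.ext (hz _) (hz _)).trans (map_one t).symm
    let φ : L →* L := powMonoidHom p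
    have hle : φ.range ≤ C := by
      rintro _ ⟨x, rfl⟩
      exact (QuotientGroup.eq_one_iff _).1 (hexp (x : L ⧸ C))
    have h1 : Nat.card (L ⧸ C) ≤ Nat.card φ.ker := by
      have h2 := φ.ker.index_mul_card
      rw [Subgroup.index_ker, ← φ.range.index_mul_card, mul_comm] at h2
      have h3 : Nat.card φ.ker = φ.range.index := Nat.eq_of_mul_eq_mul_right Nat.card_pos h2
      rw [h3]
      exact Nat.le_of_dvd (Nat.pos_of_ne_zero Subgroup.index_ne_zero_of_finite)
        (Subgroup.index_dvd_of_le hle)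
    have h2 : Nat.card φ.ker ≤ p * p := by
      let ψ : φ.ker → (powMonoidHom p : G →* G).ker × H := fun x =>
        (⟨x.1.1.1, congrArg (fun y : L => y.1.1) x.2⟩, x.1.1.2)
      have hψ : Function.Injective ψ := by
        intro x y hxy
        have hx := congrArg (fun z => (z.1 : G)) hxy
        have hy := congrArg Prod.snd hxy
        exact Subtype.ext (Subtype.ext (Prod.ext hx hy))
      refine (Nat.card_le_card_of_injective ψ hψ).trans ?_
      rw [Nat.card_prod, hH, IsCyclic.card_powMonoidHom_ker]
      exact Nat.mul_le_mul_right p (Nat.gcd_le_right _ hp.pos)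
    have h3 := (hcard ▸ h1).trans h2
    have h4 : p * p * 1 < p * p * p :=
      Nat.mul_lt_mul_of_pos_left hp.one_lt (Nat.mul_pos hp.pos hp.pos)
    omega
  -- A rotation by 1 commuting with a reflection forces 2 = 0 modulo 2^m, against m ≥ 2.
  · have h := congrArg t (hcomm (t.symm (.r 1)) (t.symm (.sr 0)))
    simp only [map_mul, MulEquiv.apply_symm_apply, DihedralGroup.r_mul_sr, DihedralGroup.sr_mul_r,
      DihedralGroup.sr.injEq] at h
    have h2 : ((2 : ℕ) : ZMod (2 ^ m)) = 0 := by
      push_cast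
      linear_combination -h
    rw [ZMod.natCast_eq_zero_iff] at h2
    have h3 := Nat.le_of_dvd two_pos h2
    have h4 : 2 ^ 2 ≤ 2 ^ m := Nat.pow_le_pow_right two_pos hm
    omega
  · exact hab (hcomm a b)

/-! ### The proposition for commutative groups -/

theorem relPermMap_bijective_and_rank (p k : ℕ) (hp : p.Prime) {G : Type u} {H : Type v}
    [CommGroup G] [CommGroup H] [Finite G] [Finite H] [IsCyclic G] (hG : Nat.card G = p ^ k)
    (hH : Nat.card H = p) :
    Function.Bijective (relPermMap G H) ∧
    (Module.Free ℤ (RelA G H) ∧ Module.finrank ℤ (RelA G H) = k * p + 1) ∧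
    (Module.Free ℤ (RelR G H) ∧ Module.finrank ℤ (RelR G H) = k * p + 1) ∧
    relBurnsideKernel G H = ⊥ ∧ KernelIsInduced G H p := by
  have hbij : Function.Bijective (relPermMap G H) :=
    ⟨relPermMap_injective, relPermMap_surjective hp hG hH⟩
  have hker : relBurnsideKernel G H = ⊥ :=
    (AddMonoidHom.ker_eq_bot_iff (relPermMap G H)).2 hbij.1
  let b : Module.Basis (FreeSubgroup G H) ℤ (RelA G H) :=
    .ofRepr (LinearEquiv.ofBijective cosetMap cosetMap_bijective).symm
  let e : RelA G H ≃ₗ[ℤ] RelR G H :=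
    (AddEquiv.ofBijective (relPermMap G H) hbij).toIntLinearEquiv
  refine ⟨hbij, ⟨.of_basis b, ?_⟩, ⟨.of_basis (b.map e), ?_⟩, hker, ?_⟩
  · rw [Module.finrank_eq_nat_card_basis b, card_freeSubgroup hp hG hH]
  · rw [Module.finrank_eq_nat_card_basis (b.map e), card_freeSubgroup hp hG hH]
  · rw [KernelIsInduced, hker, AddSubgroup.map_bot]
    refine (le_antisymm bot_le ?_)
    refine iSup_le fun L => iSup_le fun C => iSup_le fun hC => iSup_le fun hT => ?_
    exact absurd hT (not_isBasicSubquotient hp hG hH L C)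

end RelBurnside

theorem mainTheorem4 (p k : ℕ) (hp : p.Prime) {G : Type u} {H : Type v} [Group G] [Group H]
    [Finite G] [Finite H] [IsCyclic G] (hG : Nat.card G = p ^ k)
    (hH : Nonempty (H ≃* Multiplicative (ZMod p))) :
    Function.Bijective (RelBurnside.relPermMap G H) ∧
    (Module.Free ℤ (RelBurnside.RelA G H) ∧
      Module.finrank ℤ (RelBurnside.RelA G H) = k * p + 1) ∧
    (Module.Free ℤ (RelBurnside.RelR G H) ∧
      Module.finrank ℤ (RelBurnside.RelR G H) = k * p + 1) ∧
    RelBurnside.relBurnsideKernel G H = ⊥ ∧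
    RelBurnside.KernelIsInduced G H p := by
  obtain ⟨e⟩ := hH
  have hNe : NeZero p := ⟨hp.ne_zero⟩
  have hcard : Nat.card H = p := by rw [Nat.card_congr e.toEquiv]; simp
  have hHcomm : ∀ a b : H, a * b = b * a := fun a b => e.injective (by
    rw [map_mul, map_mul, mul_comm])
  -- These structures extend the given group structures, so the statement proved for commutative
  -- groups is the required one.
  let _ : CommGroup G := IsCyclic.commGroup
  let _ : CommGroup H := { ‹Group H› with mul_comm := hHcomm }
  exact RelBurnside.relPermMap_bijective_and_rank p k hp hG hcard
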